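/- Let $m,n\ge 3$ be integers and let the $mn$ edges of the complete bipartite graph $K_{m,n}$ be given independent exponentially distributed costs of mean $1$. Let $C_{3,m,n}$ be the minimum total cost of a $3$-matching, that is, of a set of three edges no two of which have a vertex in common, and let $F_{3,m,n}(t)=\mathbb{E}\left[\exp(t\,C_{3,m,n})\right]$ be its moment generating function. The expectation converges for all complex $t$ with $\operatorname{Re} t<mn/3$ and is there equal to a rational function of $t$; we also denote by $F_{3,m,n}$ this rational function, which is the meromorphic continuation of the moment generating function to the complex plane. Then $F_{3,m,n}(t)$ has no zero in the closed disk $|t|\le mn/3$. In particular, $\mathbb{E}\left[\exp(t\,C_{3,m,n})\right]\ne 0$ for all $t\ne mn/3$ with $|t|\le mn/3$. -/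

import Mathlib

open MeasureTheory ProbabilityTheory

/-- The edge of the complete bipartite graph `K_{m,n}` joining the `i`-th vertex on the left to the
`j`-th vertex on the right is the pair `(i, j)`. A set of edges is a `k`-matching if it consists of
exactly `k` edges, no two of which have a vertex in common. -/
def IsKMatching (k : ℕ) {m n : ℕ} (M : Finset (Fin m × Fin n)) : Prop :=
  M.card = k ∧ ∀ e ∈ M, ∀ f ∈ M, e ≠ f → e.1 ≠ f.1 ∧ e.2 ≠ f.2

/-- The minimum total cost of a `k`-matching in `K_{m,n}` for the edge costs `c`. There are only
finitely many `k`-matchings, and at least one if `k ≤ min m n`, so the infimum is a minimum. -/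
noncomputable def minMatchingCost (k : ℕ) {m n : ℕ} (c : Fin m × Fin n → ℝ) : ℝ :=
  ⨅ M : {M : Finset (Fin m × Fin n) // IsKMatching k M}, ∑ e ∈ M.1, c e

/-! Let the rows `A` and columns `B` form a smallest cover of the edges whose cost is already zero,
put `S = Aᶜ ×ˢ Bᶜ` and `w = 3 - |A| - |B|`. Every 3-matching has at least `w` edges in `S`, and
exchanges with zero edges show that some cheapest one has at most `w`. Raising all costs in `S` by
`u` therefore raises the minimum by exactly `w * u`. The least cost in `S` is exponential of rate
`|S|` and sits at a uniformly random edge; by memorylessness, subtracting it leaves the other costs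
in `S` exponential. So the expectation of `exp (t * cost)` is the sum, over `e ∈ S`, of its value
with `e` made free, divided by `|S| - w * t` (`lintegral_pi_eq_sum_update_zero`,
`zeroedMGF_eq_sum`).

Starting from no zeros, only seven nonempty configurations occur, up to zeros that do not matter,
before three independent zeros make the cost vanish. Solving the recursion gives a cubic in `t`,
times a constant, over six linear factors (`threeMatchingMGF_eq`).

Expanded in `z = m * n / 3 - t`, the cubic satisfies the Routh-Hurwitz conditions, hence has no zero
with `Re t ≤ m * n / 3`, a half-plane that contains the disk (`numerator_ne_zero`). The recursion is
carried out for real `t`; the identity theorem extends the formula to complex `t`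
(`complexMGF_minMatchingCost`). -/

/-! ### The exponential distribution of mean 1 -/

lemma lintegral_expMeasure_one {f : ℝ → ENNReal} (hf : Measurable f) :
    ∫⁻ u, f u ∂(expMeasure 1) =
      ∫⁻ u in Set.Ici (0 : ℝ), ENNReal.ofReal (Real.exp (-u)) * f u := by
  have h : (expMeasure 1 : Measure ℝ) = volume.withDensity (exponentialPDF 1) := rfl
  rw [h, lintegral_withDensity_eq_lintegral_mul _ (by
    exact (measurable_exponentialPDFReal 1).ennreal_ofReal) hf,
    ← lintegral_indicator measurableSet_Ici]
  refine lintegral_congr fun u => ?_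
  by_cases hu : 0 ≤ u
  · simp [Set.indicator, hu, exponentialPDF_of_nonneg]
  · simp [Set.indicator, hu, exponentialPDF_of_neg (not_le.1 hu)]

instance nullSingletonClass_expMeasure_one : NullSingletonClass (expMeasure 1) := by
  have h : (expMeasure 1 : Measure ℝ) = volume.withDensity (exponentialPDF 1) := rfl
  rw [h]
  exact ⟨fun x => withDensity_absolutelyContinuous _ _ (measure_singleton x)⟩

lemma ae_nonneg_expMeasure_one : ∀ᵐ u ∂(expMeasure 1), 0 ≤ u := by
  have hs : {u : ℝ | ¬ 0 ≤ u} = Set.Iio 0 := by ext; simp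
  rw [ae_iff, hs, ← lintegral_indicator_one measurableSet_Iio,
    lintegral_expMeasure_one (measurable_one.indicator measurableSet_Iio),
    setLIntegral_congr_fun (g := fun _ => 0) measurableSet_Ici]
  · simp
  · intro u hu
    simp only [Set.mem_Ici] at hu
    simp [Set.indicator, not_lt.2 hu]

/-- The memoryless property of the exponential distribution. -/
lemma lintegral_expMeasure_one_memoryless {h : ℝ → ENNReal} (hh : Measurable h) {u : ℝ}
    (hu : 0 ≤ u) :
    ∫⁻ y, (Set.Ioi u).indicator h y ∂(expMeasure 1) =
      ENNReal.ofReal (Real.exp (-u)) * ∫⁻ y, h (y + u) ∂(expMeasure 1) := by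
  rw [lintegral_expMeasure_one (hh.indicator measurableSet_Ioi),
    lintegral_expMeasure_one (by fun_prop), ← lintegral_const_mul _ (by fun_prop),
    ← lintegral_indicator measurableSet_Ici, ← setLIntegral_congr Ioi_ae_eq_Ici,
    ← lintegral_indicator measurableSet_Ioi,
    ← lintegral_add_right_eq_self _ u]
  refine lintegral_congr fun y => ?_
  by_cases hy : 0 < y
  · have h1 : 0 ≤ y + u := by linarith
    simp [Set.indicator, hy, h1]
    rw [← mul_assoc, ← ENNReal.ofReal_mul (Real.exp_nonneg _), ← Real.exp_add]
  · simp [Set.indicator, hy]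

lemma lintegral_exp_mul_expMeasure_one {a : ℝ} (ha : a < 1) :
    ∫⁻ u, ENNReal.ofReal (Real.exp (a * u)) ∂(expMeasure 1) = ENNReal.ofReal (1 / (1 - a)) := by
  rw [lintegral_expMeasure_one (by fun_prop), ← setLIntegral_congr Ioi_ae_eq_Ici]
  have h (u : ℝ) : ENNReal.ofReal (Real.exp (-u)) * ENNReal.ofReal (Real.exp (a * u)) =
      ENNReal.ofReal (Real.exp ((a - 1) * u)) := by
    rw [← ENNReal.ofReal_mul (Real.exp_nonneg _), ← Real.exp_add]
    ring_nf
  simp_rw [h]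
  rw [← ofReal_integral_eq_lintegral_ofReal (integrableOn_exp_mul_Ioi (by linarith) 0)
    (Filter.Eventually.of_forall fun _ => Real.exp_nonneg _),
    integral_exp_mul_Ioi (by linarith)]
  congr 1
  rw [mul_zero, Real.exp_zero, neg_div, ← div_neg, neg_sub]

/-! ### Independent exponential variables and the least of them -/

section MemorylessProperty

variable {ι : Type*} [Fintype ι] [DecidableEq ι]

/-- Fubini as resampling: one coordinate is integrated separately without leaving the product space.
-/
lemma lintegral_pi_eq_lintegral_update (ν : Measure ℝ) [IsProbabilityMeasure ν]
    {f : (ι → ℝ) → ENNReal} (hf : Measurable f) (e : ι) :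
    ∫⁻ x, f x ∂(Measure.pi fun _ : ι => ν) =
      ∫⁻ x, ∫⁻ u, f (Function.update x e u) ∂ν ∂(Measure.pi fun _ : ι => ν) := by
  have hg : Measurable fun x : ι → ℝ => ∫⁻ u, f (Function.update x e u) ∂ν := by
    exact Measurable.lintegral_prod_right (hf.comp measurable_update')
  have he : e ∉ Finset.univ.erase e := by simp
  have hu : insert e (Finset.univ.erase e) = (Finset.univ : Finset ι) := by simp
  rw [lintegral_eq_lmarginal_univ (f := fun x : ι → ℝ => ∫⁻ u, f (Function.update x e u) ∂ν) 0, ← hu,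
    lmarginal_insert _ hg he]
  have h := lmarginal_insert' (μ := fun _ : ι => ν) f hf he
  simp_rw [← h, hu]
  simp [lmarginal_univ]

lemma ae_ne_pi (ν : Measure ℝ) [IsProbabilityMeasure ν] [NullSingletonClass ν] {e e' : ι} (h : e ≠ e') :
    ∀ᵐ x ∂(Measure.pi fun _ : ι => ν), x e ≠ x e' := by
  have hm : MeasurableSet {x : ι → ℝ | x e = x e'} :=
    measurableSet_eq_fun (measurable_pi_apply e) (measurable_pi_apply e')
  rw [ae_iff]
  simp only [ne_eq, not_not]
  rw [← lintegral_indicator_one hm,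
    lintegral_pi_eq_lintegral_update ν (measurable_one.indicator hm) e]
  rw [lintegral_eq_zero_of_ae_eq_zero]
  refine Filter.Eventually.of_forall fun x => ?_
  have : (fun u => ({x : ι → ℝ | x e = x e'}.indicator 1 (Function.update x e u) : ENNReal)) =
      ({x e'} : Set ℝ).indicator 1 := by
    ext u
    simp [Set.indicator, h.symm]
  simp only [this, Pi.zero_apply]
  rw [lintegral_indicator_one (measurableSet_singleton _), measure_singleton]

instance isProbabilityMeasure_expMeasure_one : IsProbabilityMeasure (expMeasure 1) :=
  isProbabilityMeasure_expMeasure one_pos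

lemma ae_nonneg_pi_expMeasure_one {ι : Type*} [Fintype ι] :
    ∀ᵐ x ∂(Measure.pi fun _ : ι => expMeasure 1), ∀ e, 0 ≤ x e := by
  rw [ae_all_iff]
  intro e
  exact (measurePreserving_eval (fun _ : ι => expMeasure 1) e).quasiMeasurePreserving.ae
    ae_nonneg_expMeasure_one

/-- Add `u` to the coordinates in `S`. -/
def shiftOn {ι : Type*} [DecidableEq ι] (S : Finset ι) (u : ℝ) (x : ι → ℝ) : ι → ℝ :=
  fun e => if e ∈ S then x e + u else x e

/-- The memoryless property of a family of independent exponential variables. -/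
lemma lintegral_pi_indicator_shift (T : Finset ι) {u : ℝ} (hu : 0 ≤ u) {h : (ι → ℝ) → ENNReal}
    (hh : Measurable h) :
    ∫⁻ x, {x : ι → ℝ | ∀ e ∈ T, u < x e}.indicator h x ∂(Measure.pi fun _ => expMeasure 1) =
      ENNReal.ofReal (Real.exp (-(T.card * u))) *
        ∫⁻ x, h (shiftOn T u x) ∂(Measure.pi fun _ => expMeasure 1) := by
  have hmeas (T : Finset ι) : MeasurableSet {x : ι → ℝ | ∀ e ∈ T, u < x e} := by
    have : {x : ι → ℝ | ∀ e ∈ T, u < x e} = ⋂ e ∈ T, {x | u < x e} := by ext; simp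
    rw [this]
    exact Finset.measurableSet_biInter _ fun e _ =>
      measurableSet_lt measurable_const (measurable_pi_apply e)
  induction T using Finset.induction_on generalizing h with
  | empty =>
    have (x : ι → ℝ) : shiftOn ∅ u x = x := by ext; simp [shiftOn]
    simp [this]
  | insert a T ha ih =>
    have hs : Measurable fun z : ι → ℝ => Function.update z a (z a + u) :=
      measurable_update'.comp (f := fun z : ι → ℝ => (z, z a + u)) (by fun_prop)
    have hh' : Measurable fun z : ι → ℝ => h (Function.update z a (z a + u)) := hh.comp hs
    rw [lintegral_pi_eq_lintegral_update _ (hh.indicator (hmeas _)) a]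
    -- With the other coordinates frozen this is memorylessness in the coordinate `a`; its shift is
    -- absorbed into the integrand, to which the induction hypothesis then applies.
    have key (x : ι → ℝ) :
        ∫⁻ y, {x : ι → ℝ | ∀ e ∈ insert a T, u < x e}.indicator h (Function.update x a y)
            ∂(expMeasure 1) =
          ENNReal.ofReal (Real.exp (-u)) *
          ∫⁻ y, {x : ι → ℝ | ∀ e ∈ T, u < x e}.indicator
            (fun z => h (Function.update z a (z a + u))) (Function.update x a y)
            ∂(expMeasure 1) := by
      have hm : Measurable fun y =>
          {x : ι → ℝ | ∀ e ∈ T, u < x e}.indicator h (Function.update x a y) :=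
        (hh.indicator (hmeas T)).comp (measurable_update x)
      have hne : ∀ e ∈ T, e ≠ a := fun e he h => ha (h ▸ he)
      have hmem (y : ℝ) : (∀ e ∈ T, u < Function.update x a y e) ↔ ∀ e ∈ T, u < x e := by
        refine forall₂_congr fun e he => ?_
        rw [Function.update_of_ne (hne e he)]
      have h1 := lintegral_expMeasure_one_memoryless hm hu
      convert h1 using 3 with y y
      · simp only [Set.indicator, Set.mem_ofPred_eq, Finset.forall_mem_insert, hmem,
          Function.update_self, Set.mem_Ioi]
        by_cases h2 : u < y <;> simp [h2]
      · simp only [Set.indicator, Set.mem_ofPred_eq, hmem, Function.update_self,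
          Function.update_idem]
    simp_rw [key]
    rw [lintegral_const_mul', ← lintegral_pi_eq_lintegral_update _ (hh'.indicator (hmeas T)) a,
      ih hh', ← mul_assoc, ← ENNReal.ofReal_mul (Real.exp_nonneg _), ← Real.exp_add,
      Finset.card_insert_of_notMem ha]
    · congr 1
      · push_cast; ring_nf
      · refine lintegral_congr fun x => congrArg h ?_
        ext e
        by_cases he : e = a
        · subst he; simp [shiftOn, ha]
        · simp [shiftOn, he]
    · exact ENNReal.ofReal_ne_top

/-- If a function of independent exponential variables grows like `exp (c * u)` when the variables
in `S` are shifted by `u`, then its expectation is determined by the expectations conditional on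
one of the variables in `S` being zero. -/
lemma lintegral_pi_eq_sum_update_zero (S : Finset ι) (hS : S.Nonempty) {c : ℝ} (hc : c < S.card)
    {f : (ι → ℝ) → ENNReal} (hf : Measurable f)
    (hfS : ∀ x, (∀ e, 0 ≤ x e) → ∀ u, 0 ≤ u →
      f (shiftOn S u x) = ENNReal.ofReal (Real.exp (c * u)) * f x) :
    ∫⁻ x, f x ∂(Measure.pi fun _ => expMeasure 1) =
      ENNReal.ofReal (1 / (S.card - c)) *
        ∑ e ∈ S, ∫⁻ x, f (Function.update x e 0) ∂(Measure.pi fun _ => expMeasure 1) := by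
  -- The event that `e` is the strict minimum over `S`. Ties have probability zero, so these events
  -- split the integral.
  set A : ι → Set (ι → ℝ) := fun e => {x | ∀ e' ∈ S.erase e, x e < x e'} with hA
  have hmeas (e : ι) : MeasurableSet (A e) := by
    have : A e = ⋂ e' ∈ S.erase e, {x | x e < x e'} := by ext; simp [hA]
    rw [this]
    exact Finset.measurableSet_biInter _ fun e' _ =>
      measurableSet_lt (measurable_pi_apply e) (measurable_pi_apply e')
  have hne : ∀ᵐ x ∂(Measure.pi fun _ : ι => expMeasure 1), ∀ e e', e ≠ e' → x e ≠ x e' := by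
    simp only [ae_all_iff]
    exact fun e e' h => ae_ne_pi _ h
  have hsplit : ∀ᵐ x ∂(Measure.pi fun _ : ι => expMeasure 1),
      f x = ∑ e ∈ S, (A e).indicator f x := by
    filter_upwards [hne] with x hx
    obtain ⟨e, he, hmin⟩ := S.exists_min_image x hS
    have hxe : x ∈ A e := by
      intro e' he'
      have h1 := Finset.mem_erase.1 he'
      exact lt_of_le_of_ne (hmin e' h1.2) (hx e e' h1.1.symm)
    rw [Finset.sum_eq_single e, Set.indicator_of_mem hxe]
    · intro e' he' hee'
      refine Set.indicator_of_notMem (fun h => ?_) _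
      have h1 : x e' < x e := h e (Finset.mem_erase.2 ⟨hee'.symm, he⟩)
      exact absurd h1 (not_lt.2 (hmin e' he'))
    · exact fun h => absurd he h
  rw [lintegral_congr_ae hsplit, lintegral_finsetSum _ fun e _ => hf.indicator (hmeas e),
    Finset.mul_sum]
  refine Finset.sum_congr rfl fun e he => ?_
  have hcard : ((S.erase e).card : ℝ) = S.card - 1 := by
    rw [Finset.card_erase_of_mem he, Nat.cast_sub (Finset.card_pos.2 hS), Nat.cast_one]
  rw [lintegral_pi_eq_lintegral_update _ (hf.indicator (hmeas e)) e, lintegral_lintegral_swap]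
  swap
  · exact ((hf.indicator (hmeas e)).comp measurable_update').aemeasurable
  -- Given the minimum `u` at `e`, the other `|S| - 1` coordinates exceed `u`, which contributes
  -- `exp (-(|S| - 1) * u)`. After that the point is the shift by `u` on `S` of one with `x e = 0`,
  -- which contributes `exp (c * u)`.
  have inner : ∀ᵐ u ∂(expMeasure 1),
      ∫⁻ x, (A e).indicator f (Function.update x e u) ∂(Measure.pi fun _ : ι => expMeasure 1) =
      ENNReal.ofReal (Real.exp ((c - (S.card - 1)) * u)) *
        ∫⁻ x, f (Function.update x e 0) ∂(Measure.pi fun _ => expMeasure 1) := by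
    filter_upwards [ae_nonneg_expMeasure_one] with u hu
    have h1 (x : ι → ℝ) : (A e).indicator f (Function.update x e u) =
        {x : ι → ℝ | ∀ e' ∈ S.erase e, u < x e'}.indicator
          (fun x => f (Function.update x e u)) x := by
      have : Function.update x e u ∈ A e ↔ ∀ e' ∈ S.erase e, u < x e' := by
        refine forall₂_congr fun e' he' => ?_
        rw [Function.update_self, Function.update_of_ne (Finset.ne_of_mem_erase he')]
      simp only [Set.indicator, this, Set.mem_ofPred_eq]
    simp_rw [h1]
    rw [lintegral_pi_indicator_shift (h := fun x => f (Function.update x e u)) _ hu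
      (hf.comp measurable_update_left), hcard]
    have h2 : ∀ᵐ x ∂(Measure.pi fun _ : ι => expMeasure 1),
        f (Function.update (shiftOn (S.erase e) u x) e u) =
        ENNReal.ofReal (Real.exp (c * u)) * f (Function.update x e 0) := by
      filter_upwards [ae_nonneg_pi_expMeasure_one] with x hx
      rw [← hfS _ _ u hu]
      · congr 1
        ext e'
        by_cases h : e' = e
        · subst h; simp [shiftOn, he]
        · simp [shiftOn, h]
      · intro e'
        by_cases h : e' = e
        · subst h; simp
        · simp [h, hx e']
    rw [lintegral_congr_ae h2, lintegral_const_mul' _ _ ENNReal.ofReal_ne_top, ← mul_assoc,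
      ← ENNReal.ofReal_mul (Real.exp_nonneg _), ← Real.exp_add]
    ring_nf
  rw [lintegral_congr_ae inner, lintegral_mul_const _ (by fun_prop),
    lintegral_exp_mul_expMeasure_one (by linarith)]
  congr 3
  ring

end MemorylessProperty

/-! ### Minimum matchings and the effect of raising costs -/

lemma isKMatching_iff_injOn {k m n : ℕ} {M : Finset (Fin m × Fin n)} :
    IsKMatching k M ↔ M.card = k ∧ Set.InjOn Prod.fst (M : Set (Fin m × Fin n)) ∧
      Set.InjOn Prod.snd (M : Set (Fin m × Fin n)) := by
  refine and_congr_right fun _ => ⟨fun h => ⟨fun e he f hf hef => ?_, fun e he f hf hef => ?_⟩,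
    fun h e he f hf hef => ⟨fun h' => hef (h.1 he hf h'), fun h' => hef (h.2 he hf h')⟩⟩
  · by_contra hne
    exact (h e he f hf hne).1 hef
  · by_contra hne
    exact (h e he f hf hne).2 hef

lemma minMatchingCost_le {k m n : ℕ} (c : Fin m × Fin n → ℝ) {M : Finset (Fin m × Fin n)}
    (hM : IsKMatching k M) : minMatchingCost k c ≤ ∑ e ∈ M, c e :=
  ciInf_le (f := fun M : {M : Finset (Fin m × Fin n) // IsKMatching k M} => ∑ e ∈ M.1, c e)
    (Set.finite_range _).bddBelow ⟨M, hM⟩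

lemma nonempty_kMatching {k m n : ℕ} (hm : k ≤ m) (hn : k ≤ n) :
    Nonempty {M : Finset (Fin m × Fin n) // IsKMatching k M} := by
  let f : Fin k → Fin m × Fin n := fun i => (Fin.castLE hm i, Fin.castLE hn i)
  have hf : Function.Injective f := fun i j h => Fin.castLE_injective hm (Prod.ext_iff.1 h).1
  refine ⟨Finset.univ.image f, ?_, ?_⟩
  · rw [Finset.card_image_of_injective _ hf]
    simp
  · intro e he e' he' hne
    obtain ⟨i, -, rfl⟩ := Finset.mem_image.1 he
    obtain ⟨j, -, rfl⟩ := Finset.mem_image.1 he'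
    have hij : i ≠ j := fun h => hne (h ▸ rfl)
    exact ⟨fun h => hij (Fin.castLE_injective hm h), fun h => hij (Fin.castLE_injective hn h)⟩

lemma exists_minMatchingCost_eq {k m n : ℕ} (hm : k ≤ m) (hn : k ≤ n) (c : Fin m × Fin n → ℝ) :
    ∃ M, IsKMatching k M ∧ ∑ e ∈ M, c e = minMatchingCost k c := by
  have := nonempty_kMatching hm hn
  obtain ⟨M, hM⟩ := exists_eq_ciInf_of_finite
    (f := fun M : {M : Finset (Fin m × Fin n) // IsKMatching k M} => ∑ e ∈ M.1, c e)
  exact ⟨M.1, M.2, hM⟩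

lemma minMatchingCost_nonneg {k m n : ℕ} {c : Fin m × Fin n → ℝ} (hc : ∀ e, 0 ≤ c e) :
    0 ≤ minMatchingCost k c :=
  Real.iInf_nonneg fun _ => Finset.sum_nonneg fun e _ => hc e

lemma measurable_minMatchingCost (k : ℕ) {m n : ℕ} :
    Measurable (minMatchingCost k : (Fin m × Fin n → ℝ) → ℝ) := by
  unfold minMatchingCost
  exact Measurable.iInf fun M => Finset.measurable_sum _ fun e _ => measurable_pi_apply e

/-- For costs `x`, every `k`-matching can be replaced by one that is no more expensive and has at
most `w` edges in `S`. -/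
def Exchangeable (k : ℕ) {m n : ℕ} (x : Fin m × Fin n → ℝ) (S : Finset (Fin m × Fin n)) (w : ℕ) :
    Prop :=
  ∀ M, IsKMatching k M → ∃ M', IsKMatching k M' ∧ ∑ e ∈ M', x e ≤ ∑ e ∈ M, x e ∧
    (M' ∩ S).card ≤ w

lemma sum_shiftOn {ι : Type*} [DecidableEq ι] (M S : Finset ι) (u : ℝ) (x : ι → ℝ) :
    ∑ e ∈ M, shiftOn S u x e = ∑ e ∈ M, x e + (M ∩ S).card * u := by
  have h (e : ι) : shiftOn S u x e = x e + if e ∈ S then u else 0 := by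
    unfold shiftOn
    split_ifs <;> simp
  simp_rw [h, Finset.sum_add_distrib, Finset.sum_ite_mem, Finset.sum_const, nsmul_eq_mul]

/-- The upper bound comes from exchanging an optimal matching for one with at most `w` edges in `S`,
the lower bound from every matching having at least `w` there. -/
lemma minMatchingCost_shiftOn {k m n : ℕ} (hm : k ≤ m) (hn : k ≤ n) {x : Fin m × Fin n → ℝ}
    {S : Finset (Fin m × Fin n)} {w : ℕ} (hx : Exchangeable k x S w)
    (hS : ∀ M, IsKMatching k M → w ≤ (M ∩ S).card) {u : ℝ} (hu : 0 ≤ u) :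
    minMatchingCost k (shiftOn S u x) = w * u + minMatchingCost k x := by
  apply le_antisymm
  · obtain ⟨M, hM, hMx⟩ := exists_minMatchingCost_eq hm hn x
    obtain ⟨M', hM', hle, hw⟩ := hx M hM
    refine (minMatchingCost_le _ hM').trans ?_
    rw [sum_shiftOn]
    have h1 : ((M' ∩ S).card : ℝ) ≤ w := by exact_mod_cast hw
    nlinarith
  · obtain ⟨M, hM, hMx⟩ := exists_minMatchingCost_eq hm hn (shiftOn S u x)
    rw [← hMx, sum_shiftOn]
    have h1 : (w : ℝ) ≤ ((M ∩ S).card : ℝ) := by exact_mod_cast hS M hM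
    have h2 := minMatchingCost_le x hM
    nlinarith

/-- A matching has at most one edge on each line of a cover of the complement of `S`. -/
lemma IsKMatching.le_card_inter {k m n : ℕ} {M : Finset (Fin m × Fin n)} (hM : IsKMatching k M)
    (A : Finset (Fin m)) (B : Finset (Fin n)) :
    k ≤ A.card + B.card + (M ∩ Aᶜ ×ˢ Bᶜ).card := by
  obtain ⟨hk, hr, hc⟩ := isKMatching_iff_injOn.1 hM
  have hA : (M.filter fun e => e.1 ∈ A).card ≤ A.card :=
    Finset.card_le_card_of_injOn Prod.fst (fun e he => (Finset.mem_filter.1 he).2)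
      (hr.mono fun e he => (Finset.mem_filter.1 he).1)
  have hB : (M.filter fun e => e.2 ∈ B).card ≤ B.card :=
    Finset.card_le_card_of_injOn Prod.snd (fun e he => (Finset.mem_filter.1 he).2)
      (hc.mono fun e he => (Finset.mem_filter.1 he).1)
  have hsub : M ⊆ (M.filter fun e => e.1 ∈ A) ∪ (M.filter fun e => e.2 ∈ B) ∪
      (M ∩ Aᶜ ×ˢ Bᶜ) := by
    intro e he
    simp only [Finset.mem_union, Finset.mem_filter, Finset.mem_inter, Finset.mem_product,
      Finset.mem_compl]
    tauto
  have h1 := Finset.card_le_card hsub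
  have h2 := Finset.card_union_le ((M.filter fun e => e.1 ∈ A) ∪ (M.filter fun e => e.2 ∈ B))
    (M ∩ Aᶜ ×ˢ Bᶜ)
  have h3 := Finset.card_union_le (M.filter fun e => e.1 ∈ A) (M.filter fun e => e.2 ∈ B)
  omega

/-! ### Exchange arguments, with abstract maps `r` and `c` so that rows and columns can trade places
-/

section Exchange

variable {E R C : Type*} [DecidableEq E] (r : E → R) (c : E → C) {x : E → ℝ}

lemma triple_matching {e f g : E} (hef : r e ≠ r f) (heg : r e ≠ r g) (hfg : r f ≠ r g)
    (hef' : c e ≠ c f) (heg' : c e ≠ c g) (hfg' : c f ≠ c g) :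
    ({e, f, g} : Finset E).card = 3 ∧ Set.InjOn r (({e, f, g} : Finset E) : Set E) ∧
      Set.InjOn c (({e, f, g} : Finset E) : Set E) ∧
      ∑ a ∈ ({e, f, g} : Finset E), x a = x e + x f + x g := by
  have h1 : e ≠ f := fun h => hef (h ▸ rfl)
  have h2 : e ≠ g := fun h => heg (h ▸ rfl)
  have h3 : f ≠ g := fun h => hfg (h ▸ rfl)
  refine ⟨Finset.card_eq_three.2 ⟨e, f, g, h1, h2, h3, rfl⟩, ?_, ?_, ?_⟩
  · simp only [Set.InjOn, Finset.coe_insert, Finset.coe_singleton, Set.mem_insert_iff,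
      Set.mem_singleton_iff]
    grind
  · simp only [Set.InjOn, Finset.coe_insert, Finset.coe_singleton, Set.mem_insert_iff,
      Set.mem_singleton_iff]
    grind
  · rw [Finset.sum_insert (by simp [h1, h2]), Finset.sum_insert (by simp [h3]),
      Finset.sum_singleton]
    ring

lemma exists_triple {M : Finset E} (hM : M.card = 3) (hr : Set.InjOn r (M : Set E))
    (hc : Set.InjOn c (M : Set E)) :
    ∃ a b d, M = {a, b, d} ∧ r a ≠ r b ∧ r a ≠ r d ∧ r b ≠ r d ∧ c a ≠ c b ∧ c a ≠ c d ∧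
      c b ≠ c d ∧ ∑ e ∈ M, x e = x a + x b + x d := by
  obtain ⟨a, b, d, hab, had, hbd, rfl⟩ := Finset.card_eq_three.1 hM
  have hsum : ∑ e ∈ ({a, b, d} : Finset E), x e = x a + x b + x d := by
    rw [Finset.sum_insert (by simp [hab, had]), Finset.sum_insert (by simp [hbd]),
      Finset.sum_singleton]
    ring
  refine ⟨a, b, d, rfl, ?_, ?_, ?_, ?_, ?_, ?_, hsum⟩
  · exact fun h => hab (hr (by simp) (by simp) h)
  · exact fun h => had (hr (by simp) (by simp) h)
  · exact fun h => hbd (hr (by simp) (by simp) h)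
  · exact fun h => hab (hc (by simp) (by simp) h)
  · exact fun h => had (hc (by simp) (by simp) h)
  · exact fun h => hbd (hc (by simp) (by simp) h)

/-- A `3`-matching can be made to use the row of an edge of cost zero. -/
lemma exchange_one (hx : ∀ e, 0 ≤ x e) {p : E} (hp : x p = 0) {M : Finset E} (hM : M.card = 3)
    (hr : Set.InjOn r (M : Set E)) (hc : Set.InjOn c (M : Set E)) :
    ∃ M' : Finset E, (M'.card = 3 ∧ Set.InjOn r (M' : Set E) ∧ Set.InjOn c (M' : Set E)) ∧
      ∑ e ∈ M', x e ≤ ∑ e ∈ M, x e ∧ ∃ e ∈ M', r e = r p := by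
  by_cases h : ∃ e ∈ M, r e = r p
  · exact ⟨M, ⟨hM, hr, hc⟩, le_rfl, h⟩
  obtain ⟨a, b, d, rfl, hab, had, hbd, hab', had', hbd', hsum⟩ := exists_triple r c (x := x) hM hr hc
  simp only [Finset.mem_insert, Finset.mem_singleton, exists_eq_or_imp, exists_eq_left,
    not_or] at h
  by_contra hcon
  -- No edge of the matching lies in the row of `p`. So `p` can replace the edge in its column, or
  -- any edge if there is none.
  have key : ∀ e f, r e ≠ r f → c e ≠ c f → r p ≠ r e → r p ≠ r f → c p ≠ c e → c p ≠ c f →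
      x e + x f ≤ x a + x b + x d → False := fun e f h1 h2 h3 h4 h5 h6 hle => by
    obtain ⟨h7, h8, h9, h10⟩ := triple_matching r c (x := x) h3 h4 h1 h5 h6 h2
    exact hcon ⟨{p, e, f}, ⟨h7, h8, h9⟩, by rw [h10, hsum]; linarith, p, by simp, rfl⟩
  have h1 := hx a
  have h2 := hx b
  have h3 := hx d
  by_cases ha : c a = c p
  · exact key b d hbd hbd' (Ne.symm h.2.1) (Ne.symm h.2.2) (ha ▸ hab') (ha ▸ had') (by linarith)
  by_cases hb : c b = c p
  · exact key a d had had' (Ne.symm h.1) (Ne.symm h.2.2) (Ne.symm ha) (hb ▸ hbd') (by linarith)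
  · exact key a b hab hab' (Ne.symm h.1) (Ne.symm h.2.1) (Ne.symm ha) (Ne.symm hb) (by linarith)

/-- A `3`-matching can be made to use the rows of two independent edges of cost zero. -/
lemma exchange_two (hx : ∀ e, 0 ≤ x e) {p q : E} (hp : x p = 0) (hq : x q = 0)
    (hpr : r p ≠ r q) (hpc : c p ≠ c q) {M : Finset E} (hM : M.card = 3)
    (hr : Set.InjOn r (M : Set E)) (hc : Set.InjOn c (M : Set E)) :
    ∃ M' : Finset E, (M'.card = 3 ∧ Set.InjOn r (M' : Set E) ∧ Set.InjOn c (M' : Set E)) ∧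
      ∑ e ∈ M', x e ≤ ∑ e ∈ M, x e ∧ (∃ e ∈ M', r e = r p) ∧ ∃ e ∈ M', r e = r q := by
  by_cases h : (∃ e ∈ M, r e = r p) ∧ ∃ e ∈ M, r e = r q
  · exact ⟨M, ⟨hM, hr, hc⟩, le_rfl, h⟩
  obtain ⟨a, b, d, rfl, hab, had, hbd, hab', had', hbd', hsum⟩ := exists_triple r c (x := x) hM hr hc
  have h1 := hx a
  have h2 := hx b
  have h3 := hx d
  by_contra hcon
  have free : ∀ g ∈ ({a, b, d} : Finset E), r g ≠ r p → r g ≠ r q → c g ≠ c p → c g ≠ c q → False :=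
      fun g hg h4 h5 h6 h7 => by
    obtain ⟨h8, h9, h10, h11⟩ := triple_matching r c (x := x) hpr h4.symm h5.symm hpc h6.symm h7.symm
    refine hcon ⟨{p, q, g}, ⟨h8, h9, h10⟩, ?_, ⟨p, by simp, rfl⟩, ⟨q, by simp, rfl⟩⟩
    rw [h11, ← Finset.sum_singleton x g, hp, hq, zero_add, zero_add]
    exact Finset.sum_le_sum_of_subset_of_nonneg (by simpa using hg) fun e _ _ => hx e
  have swap : ∀ z, x z = 0 → ∀ e f, e ∈ ({a, b, d} : Finset E) → f ∈ ({a, b, d} : Finset E) →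
      r e ≠ r f → c e ≠ c f → r z ≠ r e → r z ≠ r f → c z ≠ c e → c z ≠ c f →
      ((∃ g ∈ ({z, e, f} : Finset E), r g = r p) ∧ ∃ g ∈ ({z, e, f} : Finset E), r g = r q) → False :=
      fun z hz e f he hf h1 h2 h3 h4 h5 h6 huse => by
    obtain ⟨h7, h8, h9, h10⟩ := triple_matching r c (x := x) h3 h4 h1 h5 h6 h2
    refine hcon ⟨{z, e, f}, ⟨h7, h8, h9⟩, ?_, huse⟩
    rw [h10, hz, zero_add, ← Finset.sum_pair (fun h => h1 (congrArg r h))]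
    exact Finset.sum_le_sum_of_subset_of_nonneg
      (by intro g; simp only [Finset.mem_insert, Finset.mem_singleton] at he hf ⊢; grind)
      fun e _ _ => hx e
  simp only [Finset.mem_insert, Finset.mem_singleton] at h
  have free' : ∀ g ∈ ({a, b, d} : Finset E), r g = r p ∨ r g = r q ∨ c g = c p ∨ c g = c q := by
    intro g hg
    by_contra! h'
    exact (free g hg h'.1 h'.2.1 h'.2.2.1 h'.2.2.2)
  simp only [Finset.mem_insert, Finset.mem_singleton, exists_eq_or_imp, exists_eq_left,
    forall_eq_or_imp, forall_eq] at h free' swap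
  clear free hcon
  have hp' := swap p hp
  have hq' := swap q hq
  clear swap
  -- If both rows are missed, the three edges would need three distinct columns among those of `p`
  -- and `q`, by `free'`. So one row is used, say that of `p`, by an edge `g`. If `g` is not in the
  -- column of `q`, then `q` replaces the edge in its column, or any edge but `g`. If it is, `free'`
  -- forces both other edges into the column of `p`, which is impossible.
  grind

end Exchange

lemma card_inter_add_one_le {E : Type*} [DecidableEq E] {M S : Finset E} {e : E} (he : e ∈ M)
    (heS : e ∉ S) : (M ∩ S).card + 1 ≤ M.card := by
  rw [← Finset.card_erase_add_one he]
  gcongr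
  intro g hg
  rw [Finset.mem_inter] at hg
  exact Finset.mem_erase.2 ⟨fun h => heS (h ▸ hg.2), hg.1⟩

lemma card_inter_add_two_le {E : Type*} [DecidableEq E] {M S : Finset E} {e f : E} (he : e ∈ M)
    (hf : f ∈ M) (hef : e ≠ f) (heS : e ∉ S) (hfS : f ∉ S) : (M ∩ S).card + 2 ≤ M.card := by
  have h1 : (M ∩ S).card + 1 ≤ (M.erase e).card := by
    refine le_trans (Nat.add_le_add_right (Finset.card_le_card (t := M.erase e ∩ S) ?_) 1)
      (card_inter_add_one_le (Finset.mem_erase.2 ⟨hef.symm, hf⟩) hfS)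
    intro g hg
    rw [Finset.mem_inter] at hg ⊢
    exact ⟨Finset.mem_erase.2 ⟨fun h => heS (h ▸ hg.2), hg.1⟩, hg.2⟩
  have h2 := Finset.card_erase_add_one he
  omega

/-! ### Exchangeability for the covers used in the recursion -/

section Exchangeable

variable {m n : ℕ} {x : Fin m × Fin n → ℝ}

lemma exchangeable_compl_empty : Exchangeable 3 x ((∅ : Finset (Fin m))ᶜ ×ˢ (∅ : Finset (Fin n))ᶜ) 3 :=
  fun M hM => ⟨M, hM, le_rfl, (Finset.card_le_card Finset.inter_subset_left).trans hM.1.le⟩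

lemma exchangeable_compl_row (hx : ∀ e, 0 ≤ x e) {i : Fin m} {j : Fin n} (h : x (i, j) = 0) :
    Exchangeable 3 x ({i}ᶜ ×ˢ (∅ : Finset (Fin n))ᶜ) 2 := by
  intro M hM
  obtain ⟨h1, h2, h3⟩ := isKMatching_iff_injOn.1 hM
  obtain ⟨M', hM', hle, e, he, hei⟩ := exchange_one Prod.fst Prod.snd hx h h1 h2 h3
  refine ⟨M', isKMatching_iff_injOn.2 hM', hle, ?_⟩
  have := card_inter_add_one_le (S := {i}ᶜ ×ˢ (∅ : Finset (Fin n))ᶜ) he (by simp [hei])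
  omega

lemma exchangeable_compl_col (hx : ∀ e, 0 ≤ x e) {i : Fin m} {j : Fin n} (h : x (i, j) = 0) :
    Exchangeable 3 x ((∅ : Finset (Fin m))ᶜ ×ˢ {j}ᶜ) 2 := by
  intro M hM
  obtain ⟨h1, h2, h3⟩ := isKMatching_iff_injOn.1 hM
  obtain ⟨M', ⟨hM1, hM2, hM3⟩, hle, e, he, hei⟩ := exchange_one Prod.snd Prod.fst hx h h1 h3 h2
  refine ⟨M', isKMatching_iff_injOn.2 ⟨hM1, hM3, hM2⟩, hle, ?_⟩
  have := card_inter_add_one_le (S := (∅ : Finset (Fin m))ᶜ ×ˢ {j}ᶜ) he (by simp [hei])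
  omega

lemma exchangeable_compl_rows (hx : ∀ e, 0 ≤ x e) {i i' : Fin m} {j j' : Fin n} (hi : i ≠ i')
    (hj : j ≠ j') (h : x (i, j) = 0) (h' : x (i', j') = 0) :
    Exchangeable 3 x ({i, i'}ᶜ ×ˢ (∅ : Finset (Fin n))ᶜ) 1 := by
  intro M hM
  obtain ⟨h1, h2, h3⟩ := isKMatching_iff_injOn.1 hM
  obtain ⟨M', hM', hle, ⟨e, he, hei⟩, f, hf, hfi⟩ :=
    exchange_two Prod.fst Prod.snd hx h h' hi hj h1 h2 h3
  refine ⟨M', isKMatching_iff_injOn.2 hM', hle, ?_⟩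
  have := card_inter_add_two_le (S := {i, i'}ᶜ ×ˢ (∅ : Finset (Fin n))ᶜ) he hf
    (fun h => hi (by simpa [← h, hei] using hfi)) (by simp [hei]) (by simp [hfi])
  omega

lemma exchangeable_compl_cols (hx : ∀ e, 0 ≤ x e) {i i' : Fin m} {j j' : Fin n} (hi : i ≠ i')
    (hj : j ≠ j') (h : x (i, j) = 0) (h' : x (i', j') = 0) :
    Exchangeable 3 x ((∅ : Finset (Fin m))ᶜ ×ˢ {j, j'}ᶜ) 1 := by
  intro M hM
  obtain ⟨h1, h2, h3⟩ := isKMatching_iff_injOn.1 hM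
  obtain ⟨M', ⟨hM1, hM2, hM3⟩, hle, ⟨e, he, hei⟩, f, hf, hfi⟩ :=
    exchange_two Prod.snd Prod.fst hx h h' hj hi h1 h3 h2
  refine ⟨M', isKMatching_iff_injOn.2 ⟨hM1, hM3, hM2⟩, hle, ?_⟩
  have := card_inter_add_two_le (S := (∅ : Finset (Fin m))ᶜ ×ˢ {j, j'}ᶜ) he hf
    (fun h => hj (by simpa [← h, hei] using hfi)) (by simp [hei]) (by simp [hfi])
  omega

/-- Two lines hold at most two of the three edges, so some edge `g` avoids both. Each line has two
zeros, hence one that does not meet `g`; these two zeros and `g` form a matching of cost `x g`. -/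
lemma exchangeable_compl_cross (hx : ∀ e, 0 ≤ x e) {i a b : Fin m} {j c d : Fin n} (hab : a ≠ b)
    (hai : a ≠ i) (hbi : b ≠ i) (hcd : c ≠ d) (hcj : c ≠ j) (hdj : d ≠ j)
    (ha : x (a, j) = 0) (hb : x (b, j) = 0) (hc : x (i, c) = 0) (hd : x (i, d) = 0) :
    Exchangeable 3 x ({i}ᶜ ×ˢ {j}ᶜ) 1 := by
  intro M hM
  have h := hM.le_card_inter {i} {j}
  rw [Finset.card_singleton, Finset.card_singleton] at h
  obtain ⟨g, hg⟩ : (M ∩ {i}ᶜ ×ˢ {j}ᶜ).Nonempty := Finset.card_pos.1 (by omega)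
  simp only [Finset.mem_inter, Finset.mem_product, Finset.mem_compl, Finset.mem_singleton] at hg
  obtain ⟨hgM, hgi, hgj⟩ := hg
  obtain ⟨a', ha', hai', hag⟩ : ∃ a', x (a', j) = 0 ∧ a' ≠ i ∧ a' ≠ g.1 := by
    by_cases h : a = g.1
    · exact ⟨b, hb, hbi, fun h' => hab (h.trans h'.symm)⟩
    · exact ⟨a, ha, hai, h⟩
  obtain ⟨c', hc', hcj', hcg⟩ : ∃ c', x (i, c') = 0 ∧ c' ≠ j ∧ c' ≠ g.2 := by
    by_cases h : c = g.2
    · exact ⟨d, hd, hdj, fun h' => hcd (h.trans h'.symm)⟩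
    · exact ⟨c, hc, hcj, h⟩
  obtain ⟨h1, h2, h3, h4⟩ := triple_matching Prod.fst Prod.snd (x := x) (e := (a', j))
    (f := (i, c')) (g := g) hai' hag (Ne.symm hgi) hcj'.symm (Ne.symm hgj) hcg
  refine ⟨_, isKMatching_iff_injOn.2 ⟨h1, h2, h3⟩, ?_, ?_⟩
  · rw [h4, ha', hc', zero_add, zero_add]
    exact Finset.single_le_sum (fun e _ => hx e) hgM
  · have := card_inter_add_two_le (M := {(a', j), (i, c'), g}) (S := {i}ᶜ ×ˢ {j}ᶜ) (e := (a', j))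
      (f := (i, c')) (by simp) (by simp) (by simp [hai']) (by simp) (by simp)
    omega

end Exchangeable

/-! ### The recursion on the set of zero edges -/

/-- Replace the coordinates in `Z` by zero. -/
def zeroOn {ι : Type*} [DecidableEq ι] (Z : Finset ι) (x : ι → ℝ) : ι → ℝ :=
  fun e => if e ∈ Z then 0 else x e

lemma measurable_zeroOn {ι : Type*} [DecidableEq ι] (Z : Finset ι) : Measurable (zeroOn Z) := by
  refine measurable_pi_lambda _ fun e => ?_
  unfold zeroOn
  split_ifs <;> fun_prop

lemma zeroOn_nonneg {ι : Type*} [DecidableEq ι] (Z : Finset ι) {x : ι → ℝ} (hx : ∀ e, 0 ≤ x e)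
    (e : ι) : 0 ≤ zeroOn Z x e := by
  unfold zeroOn
  split_ifs
  exacts [le_rfl, hx e]

/-- The moment generating function at `t` of the cost of a minimum `3`-matching, when the edges in
`Z` have cost zero and all the other costs are independent exponential variables of mean `1`. -/
noncomputable def zeroedMGF {m n : ℕ} (t : ℝ) (Z : Finset (Fin m × Fin n)) : ENNReal :=
  ∫⁻ x, ENNReal.ofReal (Real.exp (t * minMatchingCost 3 (zeroOn Z x)))
    ∂(Measure.pi fun _ : Fin m × Fin n => expMeasure 1)

section zeroedMGF

variable {m n : ℕ} {t : ℝ}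

lemma zeroedMGF_eq_one {Z : Finset (Fin m × Fin n)} {i i' i'' : Fin m} {j j' j'' : Fin n}
    (h : (i, j) ∈ Z) (h' : (i', j') ∈ Z) (h'' : (i'', j'') ∈ Z) (hi : i ≠ i') (hi' : i ≠ i'')
    (hi'' : i' ≠ i'') (hj : j ≠ j') (hj' : j ≠ j'') (hj'' : j' ≠ j'') : zeroedMGF t Z = 1 := by
  have hcost : ∀ᵐ x ∂(Measure.pi fun _ : Fin m × Fin n => expMeasure 1),
      ENNReal.ofReal (Real.exp (t * minMatchingCost 3 (zeroOn Z x))) = 1 := by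
    filter_upwards [ae_nonneg_pi_expMeasure_one] with x hx
    obtain ⟨h1, h2, h3, h4⟩ := triple_matching Prod.fst Prod.snd (x := zeroOn Z x) (e := (i, j))
      (f := (i', j')) (g := (i'', j'')) hi hi' hi'' hj hj' hj''
    have h5 := minMatchingCost_le (zeroOn Z x) (isKMatching_iff_injOn.2 ⟨h1, h2, h3⟩)
    have h6 : 0 ≤ minMatchingCost 3 (zeroOn Z x) := minMatchingCost_nonneg (zeroOn_nonneg Z hx)
    have h7 : minMatchingCost 3 (zeroOn Z x) = 0 := by
      refine le_antisymm (h5.trans_eq ?_) h6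
      rw [h4]
      simp [zeroOn, h, h', h'']
    simp [h7]
  rw [zeroedMGF, lintegral_congr_ae hcost]
  simp

/-- One step of the recursion, where `A` and `B` cover `Z`. Working in `ENNReal` avoids any prior
integrability: finiteness comes out of the formula. -/
lemma zeroedMGF_eq_sum (hm : 3 ≤ m) (hn : 3 ≤ n) (A : Finset (Fin m)) (B : Finset (Fin n)) (w : ℕ)
    {Z : Finset (Fin m × Fin n)} (hw : A.card + B.card + w = 3) (hA : A.card < m) (hB : B.card < n)
    (ht : w * t < (m - A.card) * (n - B.card)) (hZ : ∀ z ∈ Z, z.1 ∈ A ∨ z.2 ∈ B)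
    (hex : ∀ x : Fin m × Fin n → ℝ, (∀ e, 0 ≤ x e) → (∀ z ∈ Z, x z = 0) →
      Exchangeable 3 x (Aᶜ ×ˢ Bᶜ) w)
    {r : Fin m → Fin n → ℝ} (hr0 : ∀ i j, 0 ≤ r i j)
    (hr : ∀ i j, i ∉ A → j ∉ B → zeroedMGF t (insert (i, j) Z) = ENNReal.ofReal (r i j)) :
    zeroedMGF t Z = ENNReal.ofReal
      ((∑ i ∈ Aᶜ, ∑ j ∈ Bᶜ, r i j) / ((m - A.card) * (n - B.card) - w * t)) := by
  set S := Aᶜ ×ˢ Bᶜ with hS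
  have hcard : (S.card : ℝ) = (m - A.card) * (n - B.card) := by
    rw [hS, Finset.card_product, Finset.card_compl, Finset.card_compl, Fintype.card_fin,
      Fintype.card_fin, Nat.cast_mul, Nat.cast_sub hA.le, Nat.cast_sub hB.le]
  have hSZ : ∀ e ∈ S, e ∉ Z := by
    intro e he heZ
    simp only [hS, Finset.mem_product, Finset.mem_compl] at he
    exact (hZ e heZ).elim he.1 he.2
  have hpos : 0 < S.card := by
    rw [hS, Finset.card_product, Finset.card_compl, Finset.card_compl, Fintype.card_fin,
      Fintype.card_fin]
    exact Nat.mul_pos (by omega) (by omega)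
  have hmeas : Measurable fun x : Fin m × Fin n → ℝ =>
      ENNReal.ofReal (Real.exp (t * minMatchingCost 3 (zeroOn Z x))) :=
    ((((measurable_minMatchingCost 3).comp (measurable_zeroOn Z)).const_mul t).exp).ennreal_ofReal
  rw [zeroedMGF, lintegral_pi_eq_sum_update_zero S (Finset.card_pos.1 hpos) (c := w * t)
    (by rw [hcard]; exact ht) hmeas]
  · have h1 : ∀ e ∈ S, ∫⁻ x, ENNReal.ofReal (Real.exp (t * minMatchingCost 3
        (zeroOn Z (Function.update x e 0)))) ∂(Measure.pi fun _ : Fin m × Fin n => expMeasure 1) =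
        ENNReal.ofReal (r e.1 e.2) := by
      intro e he
      have he' := he
      simp only [hS, Finset.mem_product, Finset.mem_compl] at he
      rw [← hr _ _ he.1 he.2, zeroedMGF]
      refine lintegral_congr fun x => ?_
      congr 4
      ext g
      by_cases hg : g = e
      · subst hg; simp [zeroOn]
      · have : g ≠ (e.1, e.2) := hg
        simp [zeroOn, hg]
    rw [Finset.sum_congr rfl h1, ← ENNReal.ofReal_sum_of_nonneg fun e _ => hr0 _ _,
      ← ENNReal.ofReal_mul (by rw [hcard]; exact (one_div_pos.2 (sub_pos.2 ht)).le), hcard, hS,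
      Finset.sum_product]
    congr 1
    ring
  · intro x hx u hu
    -- `S` misses `Z` because the lines cover `Z`, so zeroing and shifting commute.
    have h1 : zeroOn Z (shiftOn S u x) = shiftOn S u (zeroOn Z x) := by
      ext e
      by_cases he : e ∈ S
      · simp [zeroOn, shiftOn, he, hSZ e he]
      · simp [zeroOn, shiftOn, he]
    rw [h1, minMatchingCost_shiftOn hm hn (w := w) (hex _ (zeroOn_nonneg Z hx)
      fun z hz => by simp [zeroOn, hz]) (fun M hM => by have := hM.le_card_inter A B; rw [← hS] at this; omega) hu,
      ← ENNReal.ofReal_mul (Real.exp_nonneg _), ← Real.exp_add]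
    ring_nf

end zeroedMGF

lemma sum_ite_eq_const {m : ℕ} (a : Fin m) (u v : ℝ) :
    ∑ i, (if i = a then u else v) = u + (m - 1) * v := by
  have h (i : Fin m) : (if i = a then u else v) = v + if i = a then u - v else 0 := by
    split_ifs <;> ring
  simp_rw [h, Finset.sum_add_distrib]
  simp
  ring

lemma sum_ite_eq_ite_eq_const {m : ℕ} {a b : Fin m} (hab : a ≠ b) (u v w : ℝ) :
    ∑ i, (if i = a then u else if i = b then v else w) = u + v + (m - 2) * w := by
  have h (i : Fin m) : (if i = a then u else if i = b then v else w) =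
      w + ((if i = a then u - w else 0) + if i = b then v - w else 0) := by
    by_cases h1 : i = a
    · subst h1; simp [hab]
    · by_cases h2 : i = b <;> simp only [h1, h2, if_true, if_false] <;> simp [hab.symm]
  simp_rw [h, Finset.sum_add_distrib]
  simp
  ring

lemma card_compl_pair {m : ℕ} {a b : Fin m} (hab : a ≠ b) :
    ((({a, b} : Finset (Fin m))ᶜ.card : ℕ) : ℝ) = m - 2 := by
  have h := Finset.card_le_univ ({a, b} : Finset (Fin m))
  rw [Finset.card_pair hab, Fintype.card_fin] at h
  rw [Finset.card_compl, Fintype.card_fin, Finset.card_pair hab, Nat.cast_sub h]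
  norm_num

lemma card_compl_singleton {m : ℕ} (a : Fin m) :
    ((({a} : Finset (Fin m))ᶜ.card : ℕ) : ℝ) = m - 1 := by
  have h := Finset.card_le_univ ({a} : Finset (Fin m))
  rw [Finset.card_singleton, Fintype.card_fin] at h
  rw [Finset.card_compl, Fintype.card_fin, Finset.card_singleton, Nat.cast_sub h]
  norm_num

/-! ### The values of the recursion as real functions -/

section Values

variable (m n t : ℝ)

/-- The moment generating function when the zeros form a cross: two of them in a row and two in a
column, away from the intersection. -/
noncomputable def crossMGF : ℝ := (m - 1) * (n - 1) / ((m - 1) * (n - 1) - t)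

/-- The moment generating function with two zeros in a column and one in another column and row. -/
noncomputable def colPlusMGF : ℝ := (n - 2) * (m - 1 + crossMGF m n t) / (m * (n - 2) - t)

/-- The moment generating function with four zeros forming a path. -/
noncomputable def pathMGF : ℝ := m * (n - 2) / (m * (n - 2) - t)

/-- The moment generating function with two independent zeros. -/
noncomputable def diagMGF : ℝ := (m - 2) * (n - 2 + 2 * colPlusMGF m n t) / ((m - 2) * n - t)

/-- The moment generating function with three zeros, one of them in the row and in the column of
the others. -/
noncomputable def cornerMGF : ℝ :=
  (m - 2) * (n - 2 + colPlusMGF m n t + pathMGF m n t) / ((m - 2) * n - t)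

/-- The moment generating function with two zeros in a column. -/
noncomputable def colMGF : ℝ :=
  (n - 1) * (2 * cornerMGF m n t + (m - 2) * colPlusMGF m n t) / (m * (n - 1) - 2 * t)

/-- The moment generating function with one zero. -/
noncomputable def singleMGF : ℝ :=
  (m - 1) * (colMGF m n t + (n - 1) * diagMGF m n t) / ((m - 1) * n - 2 * t)

/-- The moment generating function of the cost of a minimum `3`-matching. -/
noncomputable def threeMatchingMGF : ℝ := m * n * singleMGF m n t / (m * n - 3 * t)

variable {m n t}

/-- At `t = m * n / 3` the other five rates are still nonnegative when `m, n ≥ 3`, so the first pole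
bounds them all. For `m = 3` or `n = 3` some of them vanish there too. -/
lemma rate_bounds (hm : 3 ≤ m) (hn : 3 ≤ n) (ht : t < m * n / 3) :
    0 < m * n - 3 * t ∧ 0 < (m - 1) * n - 2 * t ∧ 0 < m * (n - 1) - 2 * t ∧
      0 < (m - 2) * n - t ∧ 0 < m * (n - 2) - t ∧ 0 < (m - 1) * (n - 1) - t := by
  refine ⟨?_, ?_, ?_, ?_, ?_, ?_⟩ <;> nlinarith

lemma crossMGF_nonneg (hm : 3 ≤ m) (hn : 3 ≤ n) (ht : t < m * n / 3) : 0 ≤ crossMGF m n t :=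
  div_nonneg (mul_nonneg (by linarith) (by linarith)) (rate_bounds hm hn ht).2.2.2.2.2.le

lemma colPlusMGF_nonneg (hm : 3 ≤ m) (hn : 3 ≤ n) (ht : t < m * n / 3) : 0 ≤ colPlusMGF m n t := by
  have h := crossMGF_nonneg hm hn ht
  exact div_nonneg (mul_nonneg (by linarith) (by linarith)) (rate_bounds hm hn ht).2.2.2.2.1.le

lemma pathMGF_nonneg (hm : 3 ≤ m) (hn : 3 ≤ n) (ht : t < m * n / 3) : 0 ≤ pathMGF m n t :=
  div_nonneg (mul_nonneg (by linarith) (by linarith)) (rate_bounds hm hn ht).2.2.2.2.1.le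

lemma diagMGF_nonneg (hm : 3 ≤ m) (hn : 3 ≤ n) (ht : t < m * n / 3) : 0 ≤ diagMGF m n t := by
  have h := colPlusMGF_nonneg hm hn ht
  exact div_nonneg (mul_nonneg (by linarith) (by linarith)) (rate_bounds hm hn ht).2.2.2.1.le

lemma cornerMGF_nonneg (hm : 3 ≤ m) (hn : 3 ≤ n) (ht : t < m * n / 3) : 0 ≤ cornerMGF m n t := by
  have h := colPlusMGF_nonneg hm hn ht
  have h' := pathMGF_nonneg hm hn ht
  exact div_nonneg (mul_nonneg (by linarith) (by linarith)) (rate_bounds hm hn ht).2.2.2.1.le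

lemma colMGF_nonneg (hm : 3 ≤ m) (hn : 3 ≤ n) (ht : t < m * n / 3) : 0 ≤ colMGF m n t := by
  have h := cornerMGF_nonneg hm hn ht
  have h' := mul_nonneg (show 0 ≤ m - 2 by linarith) (colPlusMGF_nonneg hm hn ht)
  exact div_nonneg (mul_nonneg (by linarith) (by linarith)) (rate_bounds hm hn ht).2.2.1.le

lemma singleMGF_nonneg (hm : 3 ≤ m) (hn : 3 ≤ n) (ht : t < m * n / 3) : 0 ≤ singleMGF m n t := by
  have h := colMGF_nonneg hm hn ht
  have h' := mul_nonneg (show 0 ≤ n - 1 by linarith) (diagMGF_nonneg hm hn ht)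
  exact div_nonneg (mul_nonneg (by linarith) (by linarith)) (rate_bounds hm hn ht).2.1.le

lemma threeMatchingMGF_nonneg (hm : 3 ≤ m) (hn : 3 ≤ n) (ht : t < m * n / 3) :
    0 ≤ threeMatchingMGF m n t :=
  div_nonneg (mul_nonneg (mul_nonneg (by linarith) (by linarith)) (singleMGF_nonneg hm hn ht))
    (rate_bounds hm hn ht).1.le

end Values

/-! ### Evaluation for each configuration of zeros, from the last to the first -/

section zeroedMGF

variable {m n : ℕ} {t : ℝ} {Z : Finset (Fin m × Fin n)}

/-- Any new zero off the two lines is independent of some zero on each of them, so the cost drops to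
zero. Further zeros on the lines change nothing; this tolerance in `hZ` keeps the list of
configurations short. -/
lemma zeroedMGF_cross (hm : 3 ≤ m) (hn : 3 ≤ n) (ht : t < m * n / 3) {i a b : Fin m}
    {j c d : Fin n} (hab : a ≠ b) (hai : a ≠ i) (hbi : b ≠ i) (hcd : c ≠ d) (hcj : c ≠ j)
    (hdj : d ≠ j) (ha : (a, j) ∈ Z) (hb : (b, j) ∈ Z) (hc : (i, c) ∈ Z) (hd : (i, d) ∈ Z)
    (hZ : ∀ z ∈ Z, z.1 = i ∨ z.2 = j) :
    zeroedMGF t Z = ENNReal.ofReal (crossMGF m n t) := by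
  have hm' : (3 : ℝ) ≤ m := by exact_mod_cast hm
  have hn' : (3 : ℝ) ≤ n := by exact_mod_cast hn
  obtain ⟨-, -, -, -, -, h⟩ := rate_bounds hm' hn' ht
  rw [zeroedMGF_eq_sum hm hn {i} {j} 1 (r := fun _ _ => 1) (by simp) (by simp; omega)
    (by simp; omega) (by simp; linarith) (by simpa using hZ)
    (fun x hx h0 => exchangeable_compl_cross hx hab hai hbi hcd hcj hdj (h0 _ ha) (h0 _ hb)
      (h0 _ hc) (h0 _ hd)) (fun _ _ => zero_le_one)]
  · congr 1
    simp only [Finset.sum_const, nsmul_eq_mul, card_compl_singleton]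
    simp [crossMGF]
  · intro i' j' hi' hj'
    rw [Finset.mem_singleton] at hi' hj'
    rw [ENNReal.ofReal_one]
    have hin : (i', j') ∈ insert (i', j') Z := Finset.mem_insert_self _ _
    obtain ⟨a', ha', hai', hag⟩ : ∃ a', (a', j) ∈ Z ∧ a' ≠ i ∧ a' ≠ i' := by
      by_cases h : a = i'
      · exact ⟨b, hb, hbi, fun h' => hab (h.trans h'.symm)⟩
      · exact ⟨a, ha, hai, h⟩
    obtain ⟨c', hc', hcj', hcg⟩ : ∃ c', (i, c') ∈ Z ∧ c' ≠ j ∧ c' ≠ j' := by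
      by_cases h : c = j'
      · exact ⟨d, hd, hdj, fun h' => hcd (h.trans h'.symm)⟩
      · exact ⟨c, hc, hcj, h⟩
    exact zeroedMGF_eq_one hin (Finset.mem_insert_of_mem ha') (Finset.mem_insert_of_mem hc')
      hag.symm hi' hai' hj' hcg.symm hcj'.symm

/-- Covering by the columns `j` and `c`, a new zero in row `i` produces a cross; in any other row it
completes three independent zeros. -/
lemma zeroedMGF_colPlus (hm : 3 ≤ m) (hn : 3 ≤ n) (ht : t < m * n / 3) {i a b : Fin m}
    {j c : Fin n} (hab : a ≠ b) (hai : a ≠ i) (hbi : b ≠ i) (hcj : c ≠ j)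
    (ha : (a, j) ∈ Z) (hb : (b, j) ∈ Z) (hc : (i, c) ∈ Z)
    (hZ : ∀ z ∈ Z, z.2 = j ∨ z = (i, c)) :
    zeroedMGF t Z = ENNReal.ofReal (colPlusMGF m n t) := by
  have hm' : (3 : ℝ) ≤ m := by exact_mod_cast hm
  have hn' : (3 : ℝ) ≤ n := by exact_mod_cast hn
  obtain ⟨-, -, -, -, h, -⟩ := rate_bounds hm' hn' ht
  have hcard := Finset.card_pair hcj
  rw [zeroedMGF_eq_sum hm hn ∅ {c, j} 1 (r := fun i' _ => if i' = i then crossMGF m n t else 1)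
    (by simp [hcard]) (by simp; omega) (by omega) (by simp [hcard]; linarith)
    (fun z hz => by rcases hZ z hz with h | h <;> simp [h])
    (fun x hx h0 => exchangeable_compl_cols hx hai.symm hcj (h0 _ hc) (h0 _ ha))]
  · congr 1
    simp only [Finset.sum_const, nsmul_eq_mul, card_compl_pair hcj, Finset.compl_empty,
      ← Finset.mul_sum, sum_ite_eq_const, hcard]
    simp [colPlusMGF, add_comm]
  · intro i' j'
    split_ifs
    exacts [crossMGF_nonneg hm' hn' ht, zero_le_one]
  · intro i' j' _ hj'
    simp only [Finset.mem_insert, Finset.mem_singleton, not_or] at hj'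
    have hin : (i', j') ∈ insert (i', j') Z := Finset.mem_insert_self _ _
    split_ifs with hi'
    · subst hi'
      exact zeroedMGF_cross hm hn ht hab hai hbi (Ne.symm hj'.1) hcj hj'.2
        (Finset.mem_insert_of_mem ha) (Finset.mem_insert_of_mem hb) (Finset.mem_insert_of_mem hc)
        hin (by simp only [Finset.mem_insert]; grind)
    · rw [ENNReal.ofReal_one]
      obtain ⟨a', ha', hai', hag⟩ : ∃ a', (a', j) ∈ Z ∧ a' ≠ i ∧ a' ≠ i' := by
        by_cases h : a = i'
        · exact ⟨b, hb, hbi, fun h' => hab (h.trans h'.symm)⟩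
        · exact ⟨a, ha, hai, h⟩
      exact zeroedMGF_eq_one hin (Finset.mem_insert_of_mem ha') (Finset.mem_insert_of_mem hc)
        hag.symm hi' hai' hj'.2 hj'.1 hcj.symm

/-- In whatever row the new zero falls, the path keeps two independent zeros outside that row, one
in each column. -/
lemma zeroedMGF_path (hm : 3 ≤ m) (hn : 3 ≤ n) (ht : t < m * n / 3) {a b d : Fin m}
    {j c : Fin n} (hab : a ≠ b) (had : a ≠ d) (hbd : b ≠ d) (hcj : c ≠ j)
    (haj : (a, j) ∈ Z) (hbj : (b, j) ∈ Z) (hac : (a, c) ∈ Z) (hdc : (d, c) ∈ Z)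
    (hZ : ∀ z ∈ Z, z.2 = j ∨ z.2 = c) :
    zeroedMGF t Z = ENNReal.ofReal (pathMGF m n t) := by
  have hm' : (3 : ℝ) ≤ m := by exact_mod_cast hm
  have hn' : (3 : ℝ) ≤ n := by exact_mod_cast hn
  obtain ⟨-, -, -, -, h, -⟩ := rate_bounds hm' hn' ht
  have hcard := Finset.card_pair hcj
  rw [zeroedMGF_eq_sum hm hn ∅ {c, j} 1 (r := fun _ _ => 1)
    (by simp [hcard]) (by simp; omega) (by omega) (by simp [hcard]; linarith)
    (fun z hz => by rcases hZ z hz with h | h <;> simp [h])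
    (fun x hx h0 => exchangeable_compl_cols hx hab hcj (h0 _ hac) (h0 _ hbj))
    (fun _ _ => zero_le_one)]
  · congr 1
    simp only [Finset.sum_const, nsmul_eq_mul, card_compl_pair hcj, Finset.compl_empty, hcard]
    simp [pathMGF]
  · intro i' j' _ hj'
    simp only [Finset.mem_insert, Finset.mem_singleton, not_or] at hj'
    have hin : (i', j') ∈ insert (i', j') Z := Finset.mem_insert_self _ _
    rw [ENNReal.ofReal_one]
    by_cases ha : i' = a
    · subst ha
      exact zeroedMGF_eq_one hin (Finset.mem_insert_of_mem hbj) (Finset.mem_insert_of_mem hdc)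
        hab had hbd hj'.2 hj'.1 hcj.symm
    by_cases hb : i' = b
    · subst hb
      exact zeroedMGF_eq_one hin (Finset.mem_insert_of_mem haj) (Finset.mem_insert_of_mem hdc)
        ha hbd had hj'.2 hj'.1 hcj.symm
    · exact zeroedMGF_eq_one hin (Finset.mem_insert_of_mem hbj) (Finset.mem_insert_of_mem hac)
        hb ha hab.symm hj'.2 hj'.1 hcj.symm

lemma zeroedMGF_diag (hm : 3 ≤ m) (hn : 3 ≤ n) (ht : t < m * n / 3) {a b : Fin m}
    {j c : Fin n} (hab : a ≠ b) (hcj : c ≠ j) :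
    zeroedMGF t {(a, j), (b, c)} = ENNReal.ofReal (diagMGF m n t) := by
  have hm' : (3 : ℝ) ≤ m := by exact_mod_cast hm
  have hn' : (3 : ℝ) ≤ n := by exact_mod_cast hn
  obtain ⟨-, -, -, h, -, -⟩ := rate_bounds hm' hn' ht
  have hcard := Finset.card_pair hab
  rw [zeroedMGF_eq_sum hm hn {a, b} ∅ 1
    (r := fun _ j' => if j' = j then colPlusMGF m n t else if j' = c then colPlusMGF m n t else 1)
    (by simp [hcard]) (by omega) (by simp; omega) (by simp [hcard]; linarith) (by simp)
    (fun x hx h0 => exchangeable_compl_rows hx hab hcj.symm (h0 (a, j) (by simp))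
      (h0 (b, c) (by simp)))]
  · congr 1
    simp only [Finset.sum_const, nsmul_eq_mul, card_compl_pair hab, Finset.compl_empty,
      sum_ite_eq_ite_eq_const hcj.symm, hcard]
    simp only [diagMGF]
    simp
    ring
  · intro i' j'
    have := colPlusMGF_nonneg hm' hn' ht
    split_ifs <;> linarith
  · intro i' j' hi' _
    simp only [Finset.mem_insert, Finset.mem_singleton, not_or] at hi'
    split_ifs with h1 h2
    · subst h1
      exact zeroedMGF_colPlus hm hn ht (i := b) (a := a) (b := i') (j := j') (c := c)
        (Ne.symm hi'.1) hab hi'.2 hcj (by simp) (by simp) (by simp) (by simp)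
    · subst h2
      exact zeroedMGF_colPlus hm hn ht (i := a) (a := b) (b := i') (j := j') (c := j)
        (Ne.symm hi'.2) hab.symm hi'.1 hcj.symm (by simp) (by simp) (by simp) (by simp)
    · rw [ENNReal.ofReal_one]
      exact zeroedMGF_eq_one (i := i') (j := j') (i' := a) (j' := j) (i'' := b) (j'' := c)
        (by simp) (by simp) (by simp) hi'.1 hi'.2 hab h1 h2 hcj.symm

lemma zeroedMGF_corner (hm : 3 ≤ m) (hn : 3 ≤ n) (ht : t < m * n / 3) {a b : Fin m}
    {j c : Fin n} (hab : a ≠ b) (hcj : c ≠ j)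
    (hZ : ∀ z, z ∈ Z ↔ z = (a, j) ∨ z = (b, j) ∨ z = (a, c)) :
    zeroedMGF t Z = ENNReal.ofReal (cornerMGF m n t) := by
  have hm' : (3 : ℝ) ≤ m := by exact_mod_cast hm
  have hn' : (3 : ℝ) ≤ n := by exact_mod_cast hn
  obtain ⟨-, -, -, h, -, -⟩ := rate_bounds hm' hn' ht
  have hcard := Finset.card_pair hab
  rw [zeroedMGF_eq_sum hm hn {a, b} ∅ 1
    (r := fun _ j' => if j' = j then colPlusMGF m n t else if j' = c then pathMGF m n t else 1)
    (by simp [hcard]) (by omega) (by simp; omega) (by simp [hcard]; linarith)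
    (by simp only [hZ]; rintro z (rfl | rfl | rfl) <;> simp)
    (fun x hx h0 => exchangeable_compl_rows hx hab hcj (h0 (a, c) (by simp [hZ]))
      (h0 (b, j) (by simp [hZ])))]
  · congr 1
    simp only [Finset.sum_const, nsmul_eq_mul, card_compl_pair hab, Finset.compl_empty,
      sum_ite_eq_ite_eq_const hcj.symm, hcard]
    simp only [cornerMGF]
    simp
    ring
  · intro i' j'
    have := colPlusMGF_nonneg hm' hn' ht
    have := pathMGF_nonneg hm' hn' ht
    split_ifs <;> linarith
  · intro i' j' hi' _
    simp only [Finset.mem_insert, Finset.mem_singleton, not_or] at hi'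
    split_ifs with h1 h2
    · subst h1
      exact zeroedMGF_colPlus hm hn ht (i := a) (a := b) (b := i') (j := j') (c := c)
        (Ne.symm hi'.2) hab.symm hi'.1 hcj (by simp [hZ]) (by simp) (by simp [hZ])
        (by simp only [Finset.mem_insert, hZ]; grind)
    · subst h2
      exact zeroedMGF_path hm hn ht (a := a) (b := b) (d := i') (j := j) (c := j')
        hab (Ne.symm hi'.1) (Ne.symm hi'.2) hcj (by simp [hZ]) (by simp [hZ]) (by simp [hZ])
        (by simp) (by simp only [Finset.mem_insert, hZ]; grind)
    · rw [ENNReal.ofReal_one]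
      exact zeroedMGF_eq_one (i := i') (j := j') (i' := b) (j' := j) (i'' := a) (j'' := c)
        (by simp) (by simp [hZ]) (by simp [hZ]) hi'.2 hi'.1 hab.symm h1 h2 hcj.symm

lemma zeroedMGF_col (hm : 3 ≤ m) (hn : 3 ≤ n) (ht : t < m * n / 3) {a b : Fin m}
    {j : Fin n} (hab : a ≠ b) :
    zeroedMGF t {(a, j), (b, j)} = ENNReal.ofReal (colMGF m n t) := by
  have hm' : (3 : ℝ) ≤ m := by exact_mod_cast hm
  have hn' : (3 : ℝ) ≤ n := by exact_mod_cast hn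
  obtain ⟨-, -, h, -, -, -⟩ := rate_bounds hm' hn' ht
  rw [zeroedMGF_eq_sum hm hn ∅ {j} 2
    (r := fun i' _ => if i' = a then cornerMGF m n t else if i' = b then cornerMGF m n t
      else colPlusMGF m n t)
    (by simp) (by simp; omega) (by simp; omega) (by simp; linarith) (by simp)
    (fun x hx h0 => exchangeable_compl_col hx (h0 (a, j) (by simp)))]
  · congr 1
    simp only [Finset.sum_const, nsmul_eq_mul, card_compl_singleton, Finset.compl_empty,
      ← Finset.mul_sum, sum_ite_eq_ite_eq_const hab]
    simp only [colMGF]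
    simp
    ring
  · intro i' j'
    have := colPlusMGF_nonneg hm' hn' ht
    have := cornerMGF_nonneg hm' hn' ht
    split_ifs <;> linarith
  · intro i' j' _ hj'
    rw [Finset.mem_singleton] at hj'
    split_ifs with h1 h2
    · subst h1
      exact zeroedMGF_corner hm hn ht (a := i') (b := b) (j := j) (c := j') hab hj'
        (by simp only [Finset.mem_insert, Finset.mem_singleton]; tauto)
    · subst h2
      exact zeroedMGF_corner hm hn ht (a := i') (b := a) (j := j) (c := j') hab.symm hj'
        (by simp only [Finset.mem_insert, Finset.mem_singleton]; tauto)
    · exact zeroedMGF_colPlus hm hn ht (i := i') (a := a) (b := b) (j := j) (c := j')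
        hab (Ne.symm h1) (Ne.symm h2) hj' (by simp) (by simp) (by simp) (by simp)

lemma zeroedMGF_single (hm : 3 ≤ m) (hn : 3 ≤ n) (ht : t < m * n / 3) (i : Fin m) (j : Fin n) :
    zeroedMGF t {(i, j)} = ENNReal.ofReal (singleMGF m n t) := by
  have hm' : (3 : ℝ) ≤ m := by exact_mod_cast hm
  have hn' : (3 : ℝ) ≤ n := by exact_mod_cast hn
  obtain ⟨-, h, -, -, -, -⟩ := rate_bounds hm' hn' ht
  rw [zeroedMGF_eq_sum hm hn {i} ∅ 2
    (r := fun _ j' => if j' = j then colMGF m n t else diagMGF m n t)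
    (by simp) (by simp; omega) (by simp; omega) (by simp; linarith) (by simp)
    (fun x hx h0 => exchangeable_compl_row hx (h0 (i, j) (by simp)))]
  · congr 1
    simp only [Finset.sum_const, nsmul_eq_mul, card_compl_singleton, Finset.compl_empty,
      sum_ite_eq_const]
    simp [singleMGF]
  · intro i' j'
    have := colMGF_nonneg hm' hn' ht
    have := diagMGF_nonneg hm' hn' ht
    split_ifs <;> linarith
  · intro i' j' hi' _
    rw [Finset.mem_singleton] at hi'
    split_ifs with h1
    · subst h1
      exact zeroedMGF_col hm hn ht hi'
    · exact zeroedMGF_diag hm hn ht hi' (Ne.symm h1)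

lemma zeroedMGF_empty (hm : 3 ≤ m) (hn : 3 ≤ n) (ht : t < m * n / 3) :
    zeroedMGF t (∅ : Finset (Fin m × Fin n)) = ENNReal.ofReal (threeMatchingMGF m n t) := by
  have hm' : (3 : ℝ) ≤ m := by exact_mod_cast hm
  have hn' : (3 : ℝ) ≤ n := by exact_mod_cast hn
  obtain ⟨h, -, -, -, -, -⟩ := rate_bounds hm' hn' ht
  rw [zeroedMGF_eq_sum hm hn ∅ ∅ 3 (r := fun _ _ => singleMGF m n t)
    (by simp) (by simp; omega) (by simp; omega) (by simp; linarith) (by simp)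
    (fun x _ _ => exchangeable_compl_empty) (fun _ _ => singleMGF_nonneg hm' hn' ht)
    (fun i j _ _ => by rw [insert_empty_eq]; exact zeroedMGF_single hm hn ht i j)]
  congr 1
  simp [threeMatchingMGF, mul_assoc]

end zeroedMGF

/-! ### The closed form -/

lemma colPlusMGF_eq {m n t : ℝ} (hm : 3 ≤ m) (hn : 3 ≤ n) (ht : t < m * n / 3) :
    colPlusMGF m n t = (n - 2) * (m - 1) * (m * (n - 1) - t) /
      ((m * (n - 2) - t) * ((m - 1) * (n - 1) - t)) := by
  obtain ⟨-, -, -, -, h5, h6⟩ := rate_bounds hm hn ht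
  have h5' := h5.ne'
  have h6' := h6.ne'
  rw [colPlusMGF, crossMGF, div_eq_div_iff h5' (mul_ne_zero h5' h6'), add_div' _ _ _ h6',
    mul_div_assoc', div_mul_eq_mul_div, div_eq_iff h6']
  ring

lemma threeMatchingMGF_eq {m n t : ℝ} (hm : 3 ≤ m) (hn : 3 ≤ n) (ht : t < m * n / 3) :
    threeMatchingMGF m n t =
      m * n * (m - 1) * (n - 1) * (m - 2) * (n - 2) *
        (m ^ 2 * n ^ 2 * (m - 1) * (n - 1) - m * n * (4 * m * n - 3 * m - 3 * n + 2) * t +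
          (5 * m * n - 2 * m - 2 * n - 1) * t ^ 2 - 2 * t ^ 3) /
      ((m * n - 3 * t) * ((m - 1) * n - 2 * t) * (m * (n - 1) - 2 * t) * ((m - 2) * n - t) *
        (m * (n - 2) - t) * ((m - 1) * (n - 1) - t)) := by
  obtain ⟨h1, h2, h3, h4, h5, h6⟩ := rate_bounds hm hn ht
  rw [threeMatchingMGF, singleMGF, colMGF, cornerMGF, diagMGF, pathMGF, colPlusMGF_eq hm hn ht]
  -- The six rates become positive atoms while denominators are cleared; they are expanded only for
  -- the final identity.
  generalize hA : m * n - 3 * t = A at *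
  generalize hB : (m - 1) * n - 2 * t = B at *
  generalize hC : m * (n - 1) - 2 * t = C at *
  generalize hD : (m - 2) * n - t = D at *
  generalize hE : m * (n - 2) - t = E at *
  generalize hF : (m - 1) * (n - 1) - t = F at *
  field_simp
  subst hA hB hC hD hE hF
  ring

/-! ### Absence of zeros by the Routh-Hurwitz criterion -/

/-- A real cubic polynomial satisfying the Routh-Hurwitz conditions has no zero in the closed right
half-plane. -/
lemma cubic_ne_zero_of_re_nonneg {b₀ b₁ b₂ b₃ : ℝ} (h₀ : 0 < b₀) (h₁ : 0 < b₁) (h₂ : 0 < b₂)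
    (h₃ : 0 < b₃) (h : b₀ * b₃ < b₁ * b₂) {z : ℂ} (hz : 0 ≤ z.re) :
    (b₀ : ℂ) + b₁ * z + b₂ * z ^ 2 + b₃ * z ^ 3 ≠ 0 := by
  obtain ⟨x, y⟩ := z
  intro heq
  have hre := congrArg Complex.re heq
  have him := congrArg Complex.im heq
  simp only [pow_succ, pow_zero, one_mul, Complex.add_re, Complex.mul_re, Complex.add_im,
    Complex.mul_im, Complex.ofReal_re, Complex.ofReal_im, Complex.zero_re, Complex.zero_im,
    zero_mul, sub_zero, add_zero, zero_add] at hre him hz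
  have hx2 : 0 ≤ x * x := mul_nonneg hz hz
  have hx3 : 0 ≤ x * x * x := mul_nonneg hx2 hz
  have p1 := mul_nonneg h₁.le hz
  have p2 := mul_nonneg h₂.le hx2
  have p3 := mul_nonneg h₃.le hx3
  have hy : y * (b₁ + 2 * b₂ * x + 3 * b₃ * (x * x) - b₃ * (y * y)) = 0 := by linarith
  rcases mul_eq_zero.1 hy with hy | hy
  · subst hy
    linarith
  -- Off the real axis the imaginary part determines `b₃ * y ^ 2`. Eliminating it from the real part
  -- leaves `b₁ * b₂ - b₀ * b₃` plus nonnegative terms equal to zero.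
  · have e : b₃ * b₀ + b₃ * b₁ * x + b₂ * b₃ * (x * x) + b₃ * b₃ * (x * x * x) =
        (b₃ * (y * y)) * (b₂ + 3 * b₃ * x) := by linear_combination b₃ * hre
    rw [show b₃ * (y * y) = b₁ + 2 * b₂ * x + 3 * b₃ * (x * x) by linarith] at e
    have q1 := mul_nonneg h₃.le p1
    have q2 := mul_nonneg h₃.le p2
    have q3 := mul_nonneg h₃.le p3
    have q4 := mul_nonneg (mul_nonneg h₂.le h₂.le) hz
    linarith

/-- The cubic factor of the numerator of the moment generating function has no zero in the
half-plane `Re t ≤ m * n / 3`. -/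
lemma numerator_ne_zero {m n : ℝ} (hm : 3 ≤ m) (hn : 3 ≤ n) {t : ℂ} (ht : t.re ≤ m * n / 3) :
    (m ^ 2 * n ^ 2 * (m - 1) * (n - 1) - m * n * (4 * m * n - 3 * m - 3 * n + 2) * t +
      (5 * m * n - 2 * m - 2 * n - 1) * t ^ 2 - 2 * t ^ 3 : ℂ) ≠ 0 := by
  obtain ⟨p, hp, rfl⟩ : ∃ p, 0 ≤ p ∧ m = p + 3 := ⟨m - 3, by linarith, by ring⟩
  obtain ⟨q, hq, rfl⟩ : ∃ q, 0 ≤ q ∧ n = q + 3 := ⟨n - 3, by linarith, by ring⟩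
  -- The `bᵢ` are the coefficients of the cubic in powers of `z = m * n / 3 - t`; the leading one is
  -- 2. In `p = m - 3` and `q = n - 3` they have only positive coefficients, and so does `b₁ * b₂ -
  -- 2 * b₀`.
  set b₀ : ℝ := 18 + 30 * (p + q) + 14 * (p ^ 2 + q ^ 2) + 2 * (p ^ 3 + q ^ 3) + 44 * (p * q) +
    58 / 3 * (p * q * (p + q)) + 8 / 3 * (p * q * (p ^ 2 + q ^ 2)) + 74 / 9 * (p ^ 2 * q ^ 2) +
    10 / 9 * (p ^ 2 * q ^ 2 * (p + q)) + 4 / 27 * (p ^ 3 * q ^ 3) with hb₀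
  set b₁ : ℝ := 42 + 35 * (p + q) + 7 * (p ^ 2 + q ^ 2) + 92 / 3 * (p * q) +
    19 / 3 * (p * q * (p + q)) + 4 / 3 * (p ^ 2 * q ^ 2) with hb₁
  set b₂ : ℝ := 14 + 7 * (p + q) + 3 * (p * q) with hb₂
  have hb : b₀ * 2 < b₁ * b₂ := by
    have : b₁ * b₂ - b₀ * 2 = 552 + 724 * (p + q) + 315 * (p ^ 2 + q ^ 2) + 45 * (p ^ 3 + q ^ 3) +
        2872 / 3 * (p * q) + 1256 / 3 * (p * q * (p + q)) + 60 * (p * q * (p ^ 2 + q ^ 2)) +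
        1646 / 9 * (p ^ 2 * q ^ 2) + 235 / 9 * (p ^ 2 * q ^ 2 * (p + q)) +
        100 / 27 * (p ^ 3 * q ^ 3) := by
      rw [hb₀, hb₁, hb₂]
      ring
    have h' : 0 < b₁ * b₂ - b₀ * 2 := by rw [this]; positivity
    linarith
  have key := cubic_ne_zero_of_re_nonneg (b₀ := b₀) (b₁ := b₁) (b₂ := b₂) (b₃ := 2)
    (by positivity) (by positivity) (by positivity) two_pos hb
    (z := (((p + 3) * (q + 3) / 3 : ℝ) : ℂ) - t) (by
      rw [Complex.sub_re, Complex.ofReal_re]; linarith)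
  convert key using 1
  rw [hb₀, hb₁, hb₂]
  push_cast
  ring

/-! ### The rational function and its lowest terms -/

section Polynomial

open Polynomial

/-- The numerator of the moment generating function. -/
noncomputable def mgfNum (m n : ℂ) : ℂ[X] :=
  C (m * n * (m - 1) * (n - 1) * (m - 2) * (n - 2)) *
    (C (m ^ 2 * n ^ 2 * (m - 1) * (n - 1)) - C (m * n * (4 * m * n - 3 * m - 3 * n + 2)) * X +
      C (5 * m * n - 2 * m - 2 * n - 1) * X ^ 2 - C 2 * X ^ 3)

/-- The denominator of the moment generating function. -/
noncomputable def mgfDenom (m n : ℂ) : ℂ[X] :=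
  (C (m * n) - C 3 * X) * (C ((m - 1) * n) - C 2 * X) * (C (m * (n - 1)) - C 2 * X) *
    (C ((m - 2) * n) - X) * (C (m * (n - 2)) - X) * (C ((m - 1) * (n - 1)) - X)

lemma eval_mgfNum (m n t : ℂ) : (mgfNum m n).eval t =
    m * n * (m - 1) * (n - 1) * (m - 2) * (n - 2) *
        (m ^ 2 * n ^ 2 * (m - 1) * (n - 1) - m * n * (4 * m * n - 3 * m - 3 * n + 2) * t +
          (5 * m * n - 2 * m - 2 * n - 1) * t ^ 2 - 2 * t ^ 3) := by
  simp only [mgfNum, eval_mul, eval_sub, eval_add, eval_C, eval_X, eval_pow]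

lemma eval_mgfDenom (m n t : ℂ) : (mgfDenom m n).eval t =
    (m * n - 3 * t) * ((m - 1) * n - 2 * t) * (m * (n - 1) - 2 * t) * ((m - 2) * n - t) *
        (m * (n - 2) - t) * ((m - 1) * (n - 1) - t) := by
  simp only [mgfDenom, eval_mul, eval_sub, eval_C, eval_X]

lemma eval_mgfNum_ne_zero {m n : ℝ} (hm : 3 ≤ m) (hn : 3 ≤ n) {t : ℂ} (ht : t.re ≤ m * n / 3) :
    (mgfNum m n).eval t ≠ 0 := by
  rw [eval_mgfNum]
  refine mul_ne_zero ?_ (numerator_ne_zero hm hn ht)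
  have h : 0 < m * n * (m - 1) * (n - 1) * (m - 2) * (n - 2) := by
    have h1 : 0 < m := by linarith
    have h2 : 0 < n := by linarith
    have h3 : 0 < m - 1 := by linarith
    have h4 : 0 < n - 1 := by linarith
    have h5 : 0 < m - 2 := by linarith
    have h6 : 0 < n - 2 := by linarith
    positivity
  exact_mod_cast h.ne'

lemma eval_mgfDenom_ne_zero {m n : ℝ} (hm : 3 ≤ m) (hn : 3 ≤ n) {t : ℂ} (ht : t.re < m * n / 3) :
    (mgfDenom m n).eval t ≠ 0 := by
  obtain ⟨h1, h2, h3, h4, h5, h6⟩ := rate_bounds hm hn ht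
  have ne {z : ℂ} {a : ℝ} (ha : 0 < a) (h : z.re = a) : z ≠ 0 := by
    rintro rfl
    exact ha.ne h
  rw [eval_mgfDenom]
  refine mul_ne_zero (mul_ne_zero (mul_ne_zero (mul_ne_zero (mul_ne_zero
    (ne h1 ?_) (ne h2 ?_)) (ne h3 ?_)) (ne h4 ?_)) (ne h5 ?_)) (ne h6 ?_) <;> simp

lemma threeMatchingMGF_eq_eval_div_eval {m n t : ℝ} (hm : 3 ≤ m) (hn : 3 ≤ n)
    (ht : t < m * n / 3) :
    (threeMatchingMGF m n t : ℂ) = (mgfNum m n).eval (t : ℂ) / (mgfDenom m n).eval (t : ℂ) := by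
  rw [threeMatchingMGF_eq hm hn ht, eval_mgfNum, eval_mgfDenom]
  push_cast
  rfl

/-- The numerator and the denominator of a fraction in lowest terms. -/
lemma ratFunc_eval_num_denom {p q : ℂ[X]} {t : ℂ} (hq : q.eval t ≠ 0) :
    (algebraMap ℂ[X] (RatFunc ℂ) p / algebraMap ℂ[X] (RatFunc ℂ) q).denom.eval t ≠ 0 ∧
      (algebraMap ℂ[X] (RatFunc ℂ) p / algebraMap ℂ[X] (RatFunc ℂ) q).num.eval t /
        (algebraMap ℂ[X] (RatFunc ℂ) p / algebraMap ℂ[X] (RatFunc ℂ) q).denom.eval t =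
      p.eval t / q.eval t := by
  have hq0 : q ≠ 0 := by rintro rfl; simp at hq
  set F := algebraMap ℂ[X] (RatFunc ℂ) p / algebraMap ℂ[X] (RatFunc ℂ) q with hF
  have hd : F.denom.eval t ≠ 0 := by
    obtain ⟨s, hs⟩ := RatFunc.denom_div_dvd p q
    intro h
    apply hq
    rw [hs, eval_mul, ← hF, h, zero_mul]
  have hpq : F.num * q = p * F.denom := by
    have h1 : algebraMap ℂ[X] (RatFunc ℂ) q ≠ 0 := RatFunc.algebraMap_ne_zero hq0
    have h2 : algebraMap ℂ[X] (RatFunc ℂ) F.denom ≠ 0 :=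
      RatFunc.algebraMap_ne_zero (RatFunc.denom_ne_zero F)
    have h3 := RatFunc.num_div_denom F
    conv_rhs at h3 => rw [hF]
    rw [div_eq_div_iff h2 h1] at h3
    exact RatFunc.algebraMap_injective ℂ (by simpa using h3)
  refine ⟨hd, ?_⟩
  rw [div_eq_div_iff hd hq, ← eval_mul, hpq, eval_mul]

/-- The reduced numerator divides `p`. Only `q ≠ 0` is needed, so this also covers the pole `t = m *
n / 3`. -/
lemma ratFunc_eval_num_ne_zero {p q : ℂ[X]} (hq : q ≠ 0) {t : ℂ} (hp : p.eval t ≠ 0) :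
    (algebraMap ℂ[X] (RatFunc ℂ) p / algebraMap ℂ[X] (RatFunc ℂ) q).num.eval t ≠ 0 := by
  obtain ⟨s, hs⟩ := RatFunc.num_div_dvd p hq
  intro h
  apply hp
  rw [hs, eval_mul, h, zero_mul]

end Polynomial

/-! ### Transfer to random costs and analytic continuation -/

section Probability

variable {Ω : Type*} [MeasurableSpace Ω] {μ : Measure Ω} {m n : ℕ} {X : Fin m × Fin n → Ω → ℝ}

lemma lintegral_exp_minMatchingCost (hm : 3 ≤ m) (hn : 3 ≤ n)
    (hlaw : ∀ e, HasLaw (X e) (expMeasure 1) μ) (hindep : iIndepFun X μ) {t : ℝ}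
    (ht : t < m * n / 3) :
    ∫⁻ ω, ENNReal.ofReal (Real.exp (t * minMatchingCost 3 fun e => X e ω)) ∂μ =
      ENNReal.ofReal (threeMatchingMGF m n t) := by
  have hX : AEMeasurable (fun ω e => X e ω) μ :=
    aemeasurable_pi_lambda _ fun e => (hlaw e).aemeasurable
  have hmap : μ.map (fun ω e => X e ω) = Measure.pi fun _ => expMeasure 1 := by
    rw [hindep.map_fun_eq_pi_map fun e => (hlaw e).aemeasurable]
    exact congrArg Measure.pi (funext fun e => (hlaw e).map_eq)
  have hmeas : Measurable fun x : Fin m × Fin n → ℝ =>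
      ENNReal.ofReal (Real.exp (t * minMatchingCost 3 x)) :=
    (((measurable_minMatchingCost 3).const_mul t).exp).ennreal_ofReal
  have hzero (x : Fin m × Fin n → ℝ) : zeroOn ∅ x = x := by ext; simp [zeroOn]
  rw [← lintegral_map' hmeas.aemeasurable hX, hmap, ← zeroedMGF_empty hm hn ht, zeroedMGF]
  simp_rw [hzero]

lemma integrable_exp_minMatchingCost (hm : 3 ≤ m) (hn : 3 ≤ n)
    (hlaw : ∀ e, HasLaw (X e) (expMeasure 1) μ) (hindep : iIndepFun X μ) {t : ℝ}
    (ht : t < m * n / 3) :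
    Integrable (fun ω => Real.exp (t * minMatchingCost 3 fun e => X e ω)) μ := by
  have hX : AEMeasurable (fun ω e => X e ω) μ :=
    aemeasurable_pi_lambda _ fun e => (hlaw e).aemeasurable
  refine ⟨((((measurable_minMatchingCost 3).const_mul t).exp).comp_aemeasurable
    hX).aestronglyMeasurable, ?_⟩
  rw [hasFiniteIntegral_iff_ofReal (Filter.Eventually.of_forall fun _ => Real.exp_nonneg _),
    lintegral_exp_minMatchingCost hm hn hlaw hindep ht]
  exact ENNReal.ofReal_lt_top

lemma mgf_minMatchingCost (hm : 3 ≤ m) (hn : 3 ≤ n)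
    (hlaw : ∀ e, HasLaw (X e) (expMeasure 1) μ) (hindep : iIndepFun X μ) {t : ℝ}
    (ht : t < m * n / 3) :
    mgf (fun ω => minMatchingCost 3 fun e => X e ω) μ t = threeMatchingMGF m n t := by
  rw [mgf, integral_eq_lintegral_of_nonneg_ae (Filter.Eventually.of_forall fun _ =>
    Real.exp_nonneg _) (integrable_exp_minMatchingCost hm hn hlaw hindep ht).1,
    lintegral_exp_minMatchingCost hm hn hlaw hindep ht, ENNReal.toReal_ofReal
    (threeMatchingMGF_nonneg (by exact_mod_cast hm) (by exact_mod_cast hn) ht)]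

lemma complexMGF_minMatchingCost (hm : 3 ≤ m) (hn : 3 ≤ n)
    (hlaw : ∀ e, HasLaw (X e) (expMeasure 1) μ) (hindep : iIndepFun X μ) {t : ℂ}
    (ht : t.re < (m : ℝ) * n / 3) :
    complexMGF (fun ω => minMatchingCost 3 fun e => X e ω) μ t =
      (mgfNum m n).eval t / (mgfDenom m n).eval t := by
  have hm' : (3 : ℝ) ≤ m := by exact_mod_cast hm
  have hn' : (3 : ℝ) ≤ n := by exact_mod_cast hn
  set U : Set ℂ := {z | z.re < (m : ℝ) * n / 3} with hU
  have hpos : (0 : ℝ) < (m : ℝ) * n / 3 := by positivity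
  have hf : AnalyticOnNhd ℂ (complexMGF (fun ω => minMatchingCost 3 fun e => X e ω) μ) U := by
    refine analyticOnNhd_complexMGF.mono fun z hz => ?_
    have hsub : Set.Iio ((m : ℝ) * n / 3) ⊆
        integrableExpSet (fun ω => minMatchingCost 3 fun e => X e ω) μ :=
      fun s hs => integrable_exp_minMatchingCost hm hn hlaw hindep hs
    exact interior_mono hsub (by rw [isOpen_Iio.interior_eq]; exact hz)
  have hden : ∀ z ∈ U, (mgfDenom m n).eval z ≠ 0 := fun z hz => by
    have := eval_mgfDenom_ne_zero hm' hn' hz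
    exact_mod_cast this
  have hg : AnalyticOnNhd ℂ (fun z => (mgfNum m n).eval z / (mgfDenom m n).eval z) U :=
    (AnalyticOnNhd.eval_polynomial _).mono (Set.subset_univ _) |>.div
      ((AnalyticOnNhd.eval_polynomial _).mono (Set.subset_univ _)) hden
  have hconn : IsPreconnected U := (convex_halfSpace_re_lt _).isPreconnected
  -- The identity theorem needs agreement only at points accumulating at 0; nonzero real points
  -- suffice.
  have hreal : ∃ᶠ z in nhdsWithin (0 : ℂ) {0}ᶜ,
      complexMGF (fun ω => minMatchingCost 3 fun e => X e ω) μ z =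
        (mgfNum m n).eval z / (mgfDenom m n).eval z := by
    have htend : Filter.Tendsto (fun x : ℝ => (x : ℂ)) (nhdsWithin 0 {0}ᶜ) (nhdsWithin 0 {0}ᶜ) := by
      refine tendsto_nhdsWithin_iff.2 ⟨?_, ?_⟩
      · exact (Complex.continuous_ofReal.tendsto' 0 0 Complex.ofReal_zero).mono_left
          nhdsWithin_le_nhds
      · filter_upwards [self_mem_nhdsWithin] with x hx
        simpa using hx
    refine htend.frequently (Filter.Eventually.frequently ?_)
    filter_upwards [nhdsWithin_le_nhds (Iio_mem_nhds hpos)] with x hx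
    rw [complexMGF_ofReal, mgf_minMatchingCost hm hn hlaw hindep hx,
      threeMatchingMGF_eq_eval_div_eval hm' hn' hx]
    norm_cast
  exact hf.eqOn_of_preconnected_of_frequently_eq hg hconn (z₀ := 0) (by simpa [hU] using hpos)
    hreal ht

end Probability

theorem propositionP {Ω : Type*} [MeasurableSpace Ω] (μ : Measure Ω) [IsProbabilityMeasure μ]
    (m n : ℕ) (hm : 3 ≤ m) (hn : 3 ≤ n)
    (X : Fin m × Fin n → Ω → ℝ)
    (hlaw : ∀ e, HasLaw (X e) (expMeasure 1) μ)
    (hindep : iIndepFun X μ)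
    (C : Ω → ℝ) (hC : ∀ ω, C ω = minMatchingCost 3 (fun e => X e ω)) :
    -- the moment generating function converges in the half-plane `Re t < mn / 3`, which contains
    -- the whole closed disk `|t| ≤ mn / 3` except for the point `t = mn / 3`
    (∀ t : ℂ, t.re < (m : ℝ) * n / 3 → Integrable (fun ω => Complex.exp (t * C ω)) μ) ∧
    -- it has no zero at the points of the disk where it converges
    (∀ t : ℂ, ‖t‖ ≤ (m : ℝ) * n / 3 → t ≠ (m : ℂ) * n / 3 → complexMGF C μ t ≠ 0) ∧
    -- it is a rational function, and this has no zero in the closed disk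
    ∃ F : RatFunc ℂ,
      (∀ t : ℂ, t.re < (m : ℝ) * n / 3 →
        F.denom.eval t ≠ 0 ∧ complexMGF C μ t = F.num.eval t / F.denom.eval t) ∧
      ∀ t : ℂ, ‖t‖ ≤ (m : ℝ) * n / 3 → F.num.eval t ≠ 0 := by
  obtain rfl : C = fun ω => minMatchingCost 3 fun e => X e ω := funext hC
  have hm' : (3 : ℝ) ≤ m := by exact_mod_cast hm
  have hn' : (3 : ℝ) ≤ n := by exact_mod_cast hn
  have hX : AEMeasurable (fun ω e => X e ω) μ :=
    aemeasurable_pi_lambda _ fun e => (hlaw e).aemeasurable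
  have hnum : ∀ t : ℂ, t.re ≤ (m : ℝ) * n / 3 → (mgfNum m n).eval t ≠ 0 := fun t ht => by
    have := eval_mgfNum_ne_zero hm' hn' ht
    exact_mod_cast this
  have hden : ∀ t : ℂ, t.re < (m : ℝ) * n / 3 → (mgfDenom m n).eval t ≠ 0 := fun t ht => by
    have := eval_mgfDenom_ne_zero hm' hn' ht
    exact_mod_cast this
  refine ⟨fun t ht => ?_, fun t ht htne => ?_,
    algebraMap _ _ (mgfNum m n) / algebraMap _ _ (mgfDenom m n), fun t ht => ?_, fun t ht => ?_⟩
  · exact integrable_cexp_mul_of_re_mem_integrableExpSet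
      ((measurable_minMatchingCost 3).comp_aemeasurable hX)
      (integrable_exp_minMatchingCost hm hn hlaw hindep ht)
  -- The disk touches the line `Re t = m * n / 3` only at the excluded point: there `|t| ≤ Re t`
  -- forces `Im t = 0`.
  · have hlt : t.re < (m : ℝ) * n / 3 := by
      refine lt_of_le_of_ne ((Complex.re_le_norm t).trans ht) fun heq => htne ?_
      have h1 := Complex.sq_norm t
      rw [Complex.normSq_apply] at h1
      have h2 : t.im * t.im ≤ 0 := by nlinarith [norm_nonneg t]
      have h3 : t.im = 0 := mul_self_eq_zero.1 (le_antisymm h2 (mul_self_nonneg _))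
      apply Complex.ext
      · rw [heq]
        have : ((m : ℂ) * n / 3) = (((m : ℝ) * n / 3 : ℝ) : ℂ) := by push_cast; rfl
        rw [this, Complex.ofReal_re]
      · rw [h3]
        have : ((m : ℂ) * n / 3) = (((m : ℝ) * n / 3 : ℝ) : ℂ) := by push_cast; rfl
        rw [this, Complex.ofReal_im]
    rw [complexMGF_minMatchingCost hm hn hlaw hindep hlt]
    exact div_ne_zero (hnum t hlt.le) (hden t hlt)
  · obtain ⟨h1, h2⟩ := ratFunc_eval_num_denom (p := mgfNum m n) (hden t ht)
    exact ⟨h1, by rw [h2, complexMGF_minMatchingCost hm hn hlaw hindep ht]⟩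
  · refine ratFunc_eval_num_ne_zero (fun h => ?_) (hnum t ((Complex.re_le_norm t).trans ht))
    have := hden 0 (by simp; positivity)
    simp [h] at this
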